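/- **Theorem 1.3.** Let $n\in\{1,2,3\}$, $0<r<R$, $\beta>0$, and write $B(0,\rho)$ for the open ball of radius $\rho$ centred at the origin of $\mathbb R^n$. Let $f\in C^1(\mathbb R)\cap C^2(\mathbb R\setminus\{0\})$ be strictly increasing with $f(0)=0$. For a control $u\in L^2(B(0,r))$ consider the state equation $$-\Delta y+f(y)=u\,\chi_{B(0,r)}\ \text{ in } B(0,R),\qquad y=0\ \text{ on }\partial B(0,R),$$ where a solution is a function $y\in H^1_0(B(0,R))$ such that $f(y)\in L^1(B(0,R))$ and $$\int_{B(0,R)}\big[\nabla y\cdot\nabla\varphi+f(y)\varphi\big]\,dx=\int_{B(0,r)}u\varphi\,dx\qquad\text{for all }\varphi\in H^1_0(B(0,R))\cap L^\infty(B(0,R)).$$ For every $u\in L^2(B(0,r))$ there is exactly one solution $y_u$. For a target $z\in L^2(B(0,R)\setminus B(0,r))$ let $$J(u)=\frac12\int_{B(0,r)}|u|^2\,dx+\frac\beta2\int_{B(0,R)\setminus B(0,r)}|y_u-z|^2\,dx,\qquad u\in L^2(B(0,r)).$$ Then there are two possibilities: 1. $f$ is linear. Then $J$ is convex for every target $z\in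 L^2(B(0,R)\setminus B(0,r))$. 2. $f$ is not linear. Then there exists a target $z\in L^2(B(0,R)\setminus B(0,r))$ such that the corresponding $J$ is not convex. -/

import Mathlib

open MeasureTheory Set Filter Topology
open scoped RealInnerProductSpace

namespace InternalControl

/-- Euclidean space of dimension `n`. -/
abbrev E (n : ℕ) : Type := EuclideanSpace ℝ (Fin n)

/-- Real-valued `L²(Ω)` (Lebesgue measure), as a Hilbert space of a.e. classes. -/
abbrev L2 {n : ℕ} (Ω : Set (E n)) : Type := Lp ℝ 2 (volume.restrict Ω)

/-- Vector fields in `L²(Ω; ℝⁿ)`. -/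
abbrev L2Vec {n : ℕ} (Ω : Set (E n)) : Type := Lp (E n) 2 (volume.restrict Ω)

/-- Test functions: smooth functions with compact support contained in `Ω`. -/
structure IsTestFunction {n : ℕ} (Ω : Set (E n)) (φ : E n → ℝ) : Prop where
  smooth : ContDiff ℝ (⊤ : ℕ∞) φ
  compact_supp : HasCompactSupport φ
  supp_subset : tsupport φ ⊆ Ω

/-- `g` is the weak (distributional) gradient of `y` in `Ω`. -/
def HasWeakGradient {n : ℕ} (Ω : Set (E n)) (y : L2 Ω) (g : L2Vec Ω) : Prop :=
  ∀ φ : E n → ℝ, IsTestFunction Ω φ →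
    ∫ x in Ω, y x • gradient φ x = - ∫ x in Ω, φ x • g x

/-- `y ∈ H¹₀(Ω)` with weak gradient `g`: the function `y` lies in the closure of the test
functions on `Ω` for the norm of `H¹(Ω)`. -/
structure MemH10 {n : ℕ} (Ω : Set (E n)) (y : L2 Ω) (g : L2Vec Ω) : Prop where
  weak_gradient : HasWeakGradient Ω y g
  approx : ∃ φ : ℕ → E n → ℝ, (∀ k, IsTestFunction Ω (φ k)) ∧
    Tendsto (fun k => eLpNorm (fun x => φ k x - y x) 2 (volume.restrict Ω)) atTop (𝓝 0) ∧
    Tendsto (fun k => eLpNorm (fun x => gradient (φ k) x - g x) 2 (volume.restrict Ω))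
      atTop (𝓝 0)

/-- `y ∈ H¹₀(Ω)` is a weak solution of `-Δ y + f(y) = u χ_ω` in `Ω`, `y = 0` on `∂Ω`:
`f(y) ∈ L¹(Ω)`, and the equation holds against every `φ ∈ H¹₀(Ω) ∩ L^∞(Ω)`. Here `h` is the
weak gradient of `φ`. -/
def IsWeakSolution {n : ℕ} (f : ℝ → ℝ) (Ω ω : Set (E n)) (u : L2 ω) (y : L2 Ω) : Prop :=
  ∃ g : L2Vec Ω, MemH10 Ω y g ∧ Integrable (fun x => f (y x)) (volume.restrict Ω) ∧
    ∀ (φ : L2 Ω) (h : L2Vec Ω), MemH10 Ω φ h → MemLp φ ⊤ (volume.restrict Ω) →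
      ∫ x in Ω, (⟪g x, h x⟫ + f (y x) * φ x) = ∫ x in ω, u x * φ x

/-- The ball `B(0, R)`, the domain of the state equation (also used for the control domain). -/
abbrev B (n : ℕ) (R : ℝ) : Set (E n) := Metric.ball 0 R

open Classical in
/-- The state `y_u` associated with the control `u ∈ L²(B(0,r))`: the weak solution of
`-Δ y + f(y) = u χ_{B(0,r)}` in `B(0,R)`, `y = 0` on `∂B(0,R)`
(the default value `0` is used only if there is no solution). -/
noncomputable def state {n : ℕ} (f : ℝ → ℝ) (R r : ℝ) (u : L2 (B n r)) : L2 (B n R) :=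
  if h : ∃ y, IsWeakSolution f (B n R) (B n r) u y then h.choose else 0

/-- The cost functional
`J(u) = ½ ∫_{B(0,r)} |u|² + (β/2) ∫_{B(0,R) \ B(0,r)} |y_u - z|²`. -/
noncomputable def J {n : ℕ} (f : ℝ → ℝ) (R r β : ℝ) (z : L2 (B n R \ B n r))
    (u : L2 (B n r)) : ℝ :=
  1 / 2 * (∫ x in B n r, |u x| ^ 2) +
    β / 2 * ∫ x in B n R \ B n r, |state f R r u x - z x| ^ 2

end InternalControl

/-! The target enters the cost through a square whose quadratic part does not depend on it: the
convexity defect of `J` along a segment is affine in `z`. If `J` is convex for every `z`, this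
affine function of `z` is bounded on one side, so its linear part vanishes. That says precisely that
the observation, `u` mapped to `y_u` outside the control ball, respects convex combinations
(`map_convex_comb_of_forall_convexOn`). Conversely, for linear `f` the observation is linear and `J`
is a sum of convex squares.

Suppose `J` is convex for every target. As `y_0 = 0`, the observation is homogeneous: `y_{tu} = t
y_u` on the annulus between the two spheres. No control acts there, so subtracting `t` times the
equation of `y_u` from that of `y_{tu}` leaves `f (t y_u) = t f (y_u)` almost everywhere
(`SatisfiesWeakEquation.ae_homogeneous`). A single nonzero value of `y_u` on the annulus then forces
`f` to be linear, by continuity.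

Some control must therefore be visible on the annulus. The constant `f 1` is
(`exists_ne_zero_outside`): were its state zero there, testing with a function that equals an
increasing function of `y - 1` on the control ball would give `y = 1` on that ball and zero gradient
everywhere, so the indicator of a ball would have zero weak gradient.

States exist by minimising a convex energy. Since `f` has no growth bound, the Euler–Lagrange
equation is reached through Fatou's lemma and truncations. Uniqueness follows from monotonicity. -/

namespace InternalControl

/-! ### Test functions, the closed graph model of H¹₀, and Poincaré's inequality. -/

section TestFunctions

variable {n : ℕ} {Ω : Set (E n)} {φ ψ : E n → ℝ}

lemma continuous_gradient (h : ContDiff ℝ (⊤ : ℕ∞) φ) : Continuous (gradient φ) :=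
  (InnerProductSpace.toDual ℝ (E n)).symm.continuous.comp (h.continuous_fderiv (by simp))

lemma gradient_eq_zero_of_notMem_tsupport {x : E n} (hx : x ∉ tsupport φ) :
    gradient φ x = 0 := by
  have : φ =ᶠ[𝓝 x] fun _ => 0 := notMem_tsupport_iff_eventuallyEq.mp hx
  rw [this.gradient_eq, gradient_fun_const]

lemma IsTestFunction.differentiable (h : IsTestFunction Ω φ) : Differentiable ℝ φ :=
  h.smooth.differentiable (by simp)

lemma IsTestFunction.continuous (h : IsTestFunction Ω φ) : Continuous φ := h.smooth.continuous

lemma IsTestFunction.hasCompactSupport_gradient (h : IsTestFunction Ω φ) :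
    HasCompactSupport (gradient φ) :=
  HasCompactSupport.intro' h.compact_supp (isClosed_tsupport φ) fun _ =>
    gradient_eq_zero_of_notMem_tsupport

lemma IsTestFunction.eq_zero (h : IsTestFunction Ω φ) {x : E n} (hx : x ∉ Ω) : φ x = 0 :=
  image_eq_zero_of_notMem_tsupport fun hx' => hx (h.supp_subset hx')

lemma IsTestFunction.gradient_eq_zero (h : IsTestFunction Ω φ) {x : E n} (hx : x ∉ Ω) :
    gradient φ x = 0 :=
  gradient_eq_zero_of_notMem_tsupport fun hx' => hx (h.supp_subset hx')

lemma IsTestFunction.memLp (h : IsTestFunction Ω φ) : MemLp φ 2 (volume.restrict Ω) :=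
  h.continuous.memLp_of_hasCompactSupport h.compact_supp

lemma IsTestFunction.memLp_top (h : IsTestFunction Ω φ) : MemLp φ ⊤ (volume.restrict Ω) :=
  h.continuous.memLp_of_hasCompactSupport h.compact_supp

lemma IsTestFunction.memLp_gradient (h : IsTestFunction Ω φ) :
    MemLp (gradient φ) 2 (volume.restrict Ω) :=
  (continuous_gradient h.smooth).memLp_of_hasCompactSupport h.hasCompactSupport_gradient

lemma IsTestFunction.mono {Ω' : Set (E n)} (h : IsTestFunction Ω φ) (hΩ : Ω ⊆ Ω') :
    IsTestFunction Ω' φ :=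
  ⟨h.smooth, h.compact_supp, h.supp_subset.trans hΩ⟩

lemma isTestFunction_zero : IsTestFunction Ω (0 : E n → ℝ) :=
  ⟨contDiff_const, HasCompactSupport.zero, by simp [tsupport]⟩

lemma IsTestFunction.add (h : IsTestFunction Ω φ) (h' : IsTestFunction Ω ψ) :
    IsTestFunction Ω (φ + ψ) :=
  ⟨h.smooth.add h'.smooth, h.compact_supp.add h'.compact_supp,
    (tsupport_add φ ψ).trans (union_subset h.supp_subset h'.supp_subset)⟩

lemma IsTestFunction.smul_left {a : E n → ℝ} (h : IsTestFunction Ω φ)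
    (ha : ContDiff ℝ (⊤ : ℕ∞) a) : IsTestFunction Ω (fun x => a x * φ x) :=
  ⟨ha.mul h.smooth, h.compact_supp.mul_left, (tsupport_mul_subset_right).trans h.supp_subset⟩

lemma IsTestFunction.comp {T : ℝ → ℝ} (h : IsTestFunction Ω φ) (hT : ContDiff ℝ (⊤ : ℕ∞) T)
    (hT0 : T 0 = 0) : IsTestFunction Ω (fun x => T (φ x)) :=
  ⟨hT.comp h.smooth, h.compact_supp.comp_left hT0,
    (closure_mono (Function.support_comp_subset hT0 φ)).trans h.supp_subset⟩

lemma gradient_add (h : IsTestFunction Ω φ) (h' : IsTestFunction Ω ψ) (x : E n) :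
    gradient (φ + ψ) x = gradient φ x + gradient ψ x := by
  simp only [gradient]
  rw [fderiv_add (h.differentiable x) (h'.differentiable x), map_add]

lemma gradient_mul {a b : E n → ℝ} {x : E n} (ha : DifferentiableAt ℝ a x)
    (hb : DifferentiableAt ℝ b x) :
    gradient (fun x => a x * b x) x = a x • gradient b x + b x • gradient a x := by
  simp only [gradient]
  rw [fderiv_fun_mul ha hb, map_add, map_smul, map_smul]

lemma gradient_comp {T : ℝ → ℝ} {x : E n} (hT : DifferentiableAt ℝ T (φ x))
    (hφ : DifferentiableAt ℝ φ x) :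
    gradient (fun x => T (φ x)) x = deriv T (φ x) • gradient φ x := by
  simp only [gradient]
  have := (hT.hasDerivAt.comp_hasFDerivAt x hφ.hasFDerivAt).fderiv
  rw [Function.comp_def] at this
  rw [this, map_smul]

lemma gradient_const_mul (c : ℝ) (h : IsTestFunction Ω φ) (x : E n) :
    gradient (c • φ) x = c • gradient φ x := by
  simp only [gradient]
  rw [fderiv_const_smul (h.differentiable x), map_smul]

lemma gradient_inner_left (e x : E n) : gradient (fun x : E n => ⟪e, x⟫) x = e := by
  have : HasGradientAt (fun x : E n => ⟪e, x⟫) e x := by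
    rw [hasGradientAt_iff_hasFDerivAt]
    exact ((InnerProductSpace.toDual ℝ (E n)) e).hasFDerivAt
  exact this.gradient

/-- Integration by parts for test functions. -/
lemma integral_smul_gradient (h : IsTestFunction Ω φ) (h' : IsTestFunction Ω ψ) :
    ∫ x in Ω, φ x • gradient ψ x = - ∫ x in Ω, ψ x • gradient φ x := by
  rw [setIntegral_eq_integral_of_forall_compl_eq_zero
      (fun x hx => by rw [h.eq_zero hx, zero_smul]),
    setIntegral_eq_integral_of_forall_compl_eq_zero
      (fun x hx => by rw [h'.eq_zero hx, zero_smul])]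
  have hc1 := continuous_gradient h.smooth
  have hc2 := continuous_gradient h'.smooth
  have i1 : Integrable (fun x => φ x • gradient ψ x) :=
    (h.continuous.smul hc2).integrable_of_hasCompactSupport h.compact_supp.smul_right
  have i2 : Integrable (fun x => ψ x • gradient φ x) :=
    (h'.continuous.smul hc1).integrable_of_hasCompactSupport h'.compact_supp.smul_right
  have i3 : Integrable (fun x => φ x * ψ x) :=
    (h.continuous.mul h'.continuous).integrable_of_hasCompactSupport h.compact_supp.mul_right
  refine ext_inner_left ℝ fun v => ?_
  rw [inner_neg_right, ← integral_inner i1, ← integral_inner i2]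
  have j1 := i1.const_inner (𝕜 := ℝ) v
  have j2 := i2.const_inner (𝕜 := ℝ) v
  simp only [inner_smul_right, inner_gradient_right, conj_trivial] at j1 j2 ⊢
  rw [integral_mul_fderiv_eq_neg_fderiv_mul_of_integrable (by simpa only [mul_comm] using j2) j1 i3
    (fun x _ => h.differentiable x) (fun x _ => h'.differentiable x)]
  simp only [mul_comm]

/-- The graph of the gradient on test functions, as a space of pairs of `L²` classes. -/
noncomputable def testGraph (Ω : Set (E n)) : Submodule ℝ (L2 Ω × L2Vec Ω) where
  carrier := {p | ∃ φ, IsTestFunction Ω φ ∧ p.1 =ᵐ[volume.restrict Ω] φ ∧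
    p.2 =ᵐ[volume.restrict Ω] gradient φ}
  zero_mem' := by
    refine ⟨0, isTestFunction_zero, Lp.coeFn_zero _ _ _, ?_⟩
    have : gradient (0 : E n → ℝ) = 0 := funext fun x => gradient_const x 0
    rw [this]
    exact Lp.coeFn_zero _ _ _
  add_mem' := by
    rintro p q ⟨φ, h, h1, h2⟩ ⟨ψ, h', h1', h2'⟩
    refine ⟨φ + ψ, h.add h', (Lp.coeFn_add _ _).trans (h1.add h1'), ?_⟩
    refine (Lp.coeFn_add _ _).trans ((h2.add h2').trans ?_)
    exact Eventually.of_forall fun x => (gradient_add h h' x).symm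
  smul_mem' := by
    rintro c p ⟨φ, h, h1, h2⟩
    refine ⟨c • φ, h.smul_left contDiff_const, (Lp.coeFn_smul _ _).trans (h1.const_smul c), ?_⟩
    refine (Lp.coeFn_smul _ _).trans ((h2.const_smul c).trans ?_)
    exact Eventually.of_forall fun x => (gradient_const_mul c h x).symm

/-- The space `H¹₀(Ω)`, as the closed space of pairs `(y, ∇y)`. -/
noncomputable def H10 (Ω : Set (E n)) : Submodule ℝ (L2 Ω × L2Vec Ω) :=
  (testGraph Ω).topologicalClosure

lemma isClosed_H10 : IsClosed (H10 Ω : Set (L2 Ω × L2Vec Ω)) :=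
  (testGraph Ω).isClosed_topologicalClosure

lemma IsTestFunction.toLp_mem_testGraph (h : IsTestFunction Ω φ) :
    (h.memLp.toLp, h.memLp_gradient.toLp) ∈ testGraph Ω :=
  ⟨φ, h, h.memLp.coeFn_toLp, h.memLp_gradient.coeFn_toLp⟩

lemma IsTestFunction.toLp_mem_H10 (h : IsTestFunction Ω φ) :
    (h.memLp.toLp, h.memLp_gradient.toLp) ∈ H10 Ω :=
  (testGraph Ω).le_topologicalClosure h.toLp_mem_testGraph

lemma IsTestFunction.memLp_smul_vec (h : IsTestFunction Ω φ) (v : E n) :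
    MemLp (fun x => φ x • v) 2 (volume.restrict Ω) :=
  (h.continuous.smul continuous_const).memLp_of_hasCompactSupport h.compact_supp.smul_right

lemma IsTestFunction.memLp_inner_gradient (h : IsTestFunction Ω φ) (v : E n) :
    MemLp (fun x => ⟪v, gradient φ x⟫) 2 (volume.restrict Ω) :=
  h.memLp_gradient.const_inner v

lemma integrable_smul_Lp {m : MeasurableSpace (E n)} {μ : Measure (E n)} {F : Type*}
    [NormedAddCommGroup F] [NormedSpace ℝ F] {a : E n → ℝ} {b : E n → F}
    (ha : MemLp a 2 μ) (hb : MemLp b 2 μ) : Integrable (fun x => a x • b x) μ :=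
  memLp_one_iff_integrable.mp (hb.smul ha)

/-- Pairing with a fixed vector turns the vector identity into L² inner products, which are
continuous in `(y, g)`. The relation is thus closed, and it passes from test functions to their
limits. -/
lemma hasWeakGradient_iff {y : L2 Ω} {g : L2Vec Ω} :
    HasWeakGradient Ω y g ↔ ∀ φ : E n → ℝ, ∀ h : IsTestFunction Ω φ, ∀ v : E n,
      ⟪y, (h.memLp_inner_gradient v).toLp⟫ = - ⟪g, (h.memLp_smul_vec v).toLp⟫ := by
  have key : ∀ φ : E n → ℝ, ∀ h : IsTestFunction Ω φ, ∀ v : E n,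
      ⟪v, ∫ x in Ω, y x • gradient φ x⟫ = ⟪y, (h.memLp_inner_gradient v).toLp⟫ ∧
      ⟪v, ∫ x in Ω, φ x • g x⟫ = ⟪g, (h.memLp_smul_vec v).toLp⟫ := by
    intro φ h v
    constructor
    · rw [← integral_inner (integrable_smul_Lp (Lp.memLp y) h.memLp_gradient), L2.inner_def]
      refine integral_congr_ae ?_
      filter_upwards [(h.memLp_inner_gradient v).coeFn_toLp] with x hx
      rw [hx, inner_smul_right]
      simp [mul_comm]
    · rw [← integral_inner (integrable_smul_Lp h.memLp (Lp.memLp g)), L2.inner_def]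
      refine integral_congr_ae ?_
      filter_upwards [(h.memLp_smul_vec v).coeFn_toLp] with x hx
      rw [hx, inner_smul_right, inner_smul_right, real_inner_comm]
  constructor
  · intro H φ h v
    rw [← (key φ h v).1, ← (key φ h v).2, H φ h, inner_neg_right]
  · intro H φ h
    refine ext_inner_left ℝ fun v => ?_
    rw [inner_neg_right, (key φ h v).1, (key φ h v).2, H φ h]

lemma isClosed_setOf_hasWeakGradient :
    IsClosed {p : L2 Ω × L2Vec Ω | HasWeakGradient Ω p.1 p.2} := by
  simp only [hasWeakGradient_iff, ofPred_forall]
  refine isClosed_iInter fun φ => isClosed_iInter fun h => isClosed_iInter fun v => ?_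
  exact isClosed_eq (by fun_prop) (by fun_prop)

lemma hasWeakGradient_of_mem_H10 {p : L2 Ω × L2Vec Ω} (hp : p ∈ H10 Ω) :
    HasWeakGradient Ω p.1 p.2 := by
  refine closure_minimal ?_ isClosed_setOf_hasWeakGradient hp
  rintro ⟨y, g⟩ ⟨φ, h, h1, h2⟩ ψ h'
  rw [integral_congr_ae (g := fun x => φ x • gradient ψ x) (by
      filter_upwards [h1] with x hx; rw [hx]),
    integral_congr_ae (f := fun x => ψ x • g x) (g := fun x => ψ x • gradient φ x) (by
      filter_upwards [h2] with x hx; rw [hx])]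
  exact integral_smul_gradient h h'

/-- The weak gradient clause of `MemH10` is automatic for limits of test functions, so only the
approximation clause matters, and H¹₀ becomes a closed subspace of a Hilbert product. -/
lemma memH10_iff {y : L2 Ω} {g : L2Vec Ω} : MemH10 Ω y g ↔ (y, g) ∈ H10 Ω := by
  constructor
  · rintro ⟨-, φ, h, h1, h2⟩
    refine mem_closure_of_tendsto (b := atTop)
      (f := fun k => ((h k).memLp.toLp, (h k).memLp_gradient.toLp)) ?_
      (Eventually.of_forall fun k => (h k).toLp_mem_testGraph)
    refine Tendsto.prodMk_nhds ?_ ?_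
    · have := (Lp.tendsto_Lp_iff_tendsto_eLpNorm'' φ (fun k => (h k).memLp) y (Lp.memLp y)).2 h1
      simpa using this
    · have := (Lp.tendsto_Lp_iff_tendsto_eLpNorm'' (fun k => gradient (φ k))
        (fun k => (h k).memLp_gradient) g (Lp.memLp g)).2 h2
      simpa using this
  · intro hp
    refine ⟨hasWeakGradient_of_mem_H10 hp, ?_⟩
    obtain ⟨s, hs, hlim⟩ := mem_closure_iff_seq_limit.mp hp
    choose φ h h1 h2 using hs
    refine ⟨φ, h, ?_, ?_⟩
    · have := (Lp.tendsto_Lp_iff_tendsto_eLpNorm' _ _).1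
        ((continuous_fst.tendsto _).comp hlim)
      refine this.congr fun k => eLpNorm_congr_ae ?_
      filter_upwards [h1 k] with x hx
      simp [hx]
    · have := (Lp.tendsto_Lp_iff_tendsto_eLpNorm' _ _).1
        ((continuous_snd.tendsto _).comp hlim)
      refine this.congr fun k => eLpNorm_congr_ae ?_
      filter_upwards [h2 k] with x hx
      simp [hx]

/-- **Poincaré inequality** on a bounded set. -/
lemma norm_fst_le_of_mem_H10 {R : ℝ} (hn : 1 ≤ n) (hΩ : Ω ⊆ Metric.ball 0 R) (hm : MeasurableSet Ω)
    (hR : 0 ≤ R) {p : L2 Ω × L2Vec Ω} (hp : p ∈ H10 Ω) : ‖p.1‖ ≤ 2 * R * ‖p.2‖ := by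
  have hcl : IsClosed {p : L2 Ω × L2Vec Ω | ‖p.1‖ ≤ 2 * R * ‖p.2‖} :=
    isClosed_le (by fun_prop) (by fun_prop)
  refine closure_minimal ?_ hcl hp
  intro p hpt
  have hw := hasWeakGradient_of_mem_H10 ((testGraph Ω).le_topologicalClosure hpt)
  obtain ⟨φ, h, h1, h2⟩ := hpt
  let e : E n := EuclideanSpace.single ⟨0, hn⟩ 1
  have he : ‖e‖ = 1 := by simp [e]
  have ha : ContDiff ℝ (⊤ : ℕ∞) (fun x : E n => ⟪e, x⟫) := contDiff_const.inner ℝ contDiff_id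
  -- With `ψ = x₁ φ`, `∂₁ψ = φ + x₁ ∂₁φ`. Integrating by parts gives `‖φ‖² = -2 ∫ x₁ φ ∂₁φ`, and
  -- `|x₁| ≤ R` yields the constant `2 * R`.
  have hψ := h.smul_left ha
  have key := hasWeakGradient_iff.1 hw _ hψ e
  have hb : ∀ᵐ x ∂volume.restrict Ω, ‖⟪e, x⟫ * ⟪e, gradient φ x⟫‖ ≤ R * ‖p.2 x‖ := by
    filter_upwards [h2, ae_restrict_mem hm] with x hx hxΩ
    rw [hx, norm_mul]
    have hxR : ‖x‖ ≤ R := (mem_ball_zero_iff.1 (hΩ hxΩ)).le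
    have t1 := norm_inner_le_norm (𝕜 := ℝ) e x
    have t2 := norm_inner_le_norm (𝕜 := ℝ) e (gradient φ x)
    rw [he, one_mul] at t1 t2
    exact mul_le_mul (t1.trans hxR) t2 (norm_nonneg _) hR
  have hM : MemLp (fun x => ⟪e, x⟫ * ⟪e, gradient φ x⟫) 2 (volume.restrict Ω) :=
    (Lp.memLp p.2).of_le_mul ((ha.continuous.mul
      (continuous_const.inner (continuous_gradient h.smooth))).aestronglyMeasurable) hb
  have e1 : ((hψ.memLp_inner_gradient e).toLp : L2 Ω) = p.1 + hM.toLp := by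
    refine Lp.ext ?_
    filter_upwards [(hψ.memLp_inner_gradient e).coeFn_toLp, Lp.coeFn_add p.1 hM.toLp,
      hM.coeFn_toLp, h1] with x x1 x2 x3 x4
    rw [x1, x2, Pi.add_apply, x3, x4, gradient_mul (ha.differentiable (by simp) x)
      (h.differentiable x), gradient_inner_left, inner_add_right, inner_smul_right,
      inner_smul_right, real_inner_self_eq_norm_sq, he]
    ring
  have e2 : ⟪p.2, (hψ.memLp_smul_vec e).toLp⟫ = ⟪p.1, hM.toLp⟫ := by
    rw [L2.inner_def, L2.inner_def]
    refine integral_congr_ae ?_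
    filter_upwards [(hψ.memLp_smul_vec e).coeFn_toLp, hM.coeFn_toLp, h1, h2] with x x1 x2 x3 x4
    rw [x1, x2, x3, x4, inner_smul_right, real_inner_comm e]
    simp only [RCLike.inner_apply, conj_trivial]
    ring
  rw [e1, e2, inner_add_right, real_inner_self_eq_norm_sq] at key
  have hMn : ‖(hM.toLp : L2 Ω)‖ ≤ R * ‖p.2‖ := by
    refine Lp.norm_le_mul_norm_of_ae_le_mul ?_
    filter_upwards [hM.coeFn_toLp, hb] with x hx hx'
    rwa [hx]
  have := abs_real_inner_le_norm p.1 hM.toLp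
  have := abs_le.1 this
  change ‖p.1‖ ≤ 2 * R * ‖p.2‖
  by_contra hcon
  push Not at hcon
  have h0 : 0 ≤ ‖p.2‖ := norm_nonneg _
  have hpos : 0 < ‖p.1‖ := lt_of_le_of_lt (by positivity) hcon
  nlinarith [mul_le_mul_of_nonneg_left hMn hpos.le]

end TestFunctions

/-! ### Convergence theorems in L². -/

section Lp

variable {α : Type*} {m : MeasurableSpace α} {μ : Measure α} {F : Type*}
  [NormedAddCommGroup F] [InnerProductSpace ℝ F]

lemma norm_sq_L2 (u : Lp F 2 μ) : ‖u‖ ^ 2 = ∫ x, ‖u x‖ ^ 2 ∂μ := by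
  rw [← real_inner_self_eq_norm_sq, L2.inner_def]
  simp only [real_inner_self_eq_norm_sq]

/-- Dominated convergence in `L²`. -/
lemma tendsto_L2_of_dominated {u : ℕ → Lp F 2 μ} {v : Lp F 2 μ} {G : Type*}
    [NormedAddCommGroup G] [InnerProductSpace ℝ G] {w : Lp G 2 μ} {C : ℝ}
    (hb : ∀ k, ∀ᵐ x ∂μ, ‖u k x - v x‖ ≤ C * ‖w x‖)
    (hlim : ∀ᵐ x ∂μ, Tendsto (fun k => u k x) atTop (𝓝 (v x))) : Tendsto u atTop (𝓝 v) := by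
  rw [tendsto_iff_norm_sub_tendsto_zero]
  have hsq : Tendsto (fun k => ‖u k - v‖ ^ 2) atTop (𝓝 0) := by
    have hc : ∀ k, ‖u k - v‖ ^ 2 = ∫ x, ‖u k x - v x‖ ^ 2 ∂μ := fun k => by
      rw [norm_sq_L2]
      refine integral_congr_ae ?_
      filter_upwards [Lp.coeFn_sub (u k) v] with x hx
      rw [hx, Pi.sub_apply]
    simp only [hc]
    have h0 : (0 : ℝ) = ∫ _, (0 : ℝ) ∂μ := by simp
    rw [h0]
    refine tendsto_integral_of_dominated_convergence (fun x => C ^ 2 * ‖w x‖ ^ 2) ?_ ?_ ?_ ?_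
    · intro k
      exact (((Lp.aestronglyMeasurable (u k)).sub (Lp.aestronglyMeasurable v)).norm.pow 2)
    · exact ((Lp.memLp w).integrable_norm_pow (by simp)).const_mul _
    · intro k
      filter_upwards [hb k] with x hx
      rw [Real.norm_of_nonneg (by positivity), ← mul_pow]
      exact pow_le_pow_left₀ (norm_nonneg _) hx 2
    · filter_upwards [hlim] with x hx
      have := ((hx.sub_const (v x)).norm).pow 2
      simpa using this
  have := hsq.sqrt
  simpa [Real.sqrt_sq (norm_nonneg _)] using this

/-- Fatou's lemma for Bochner integrals of nonnegative functions. -/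
lemma integrable_and_integral_le_of_tendsto {G : ℕ → α → ℝ} {g : α → ℝ} {c : ℕ → ℝ} {a : ℝ}
    (hint : ∀ k, Integrable (G k) μ) (hpos : ∀ k, 0 ≤ᵐ[μ] G k)
    (hlim : ∀ᵐ x ∂μ, Tendsto (fun k => G k x) atTop (𝓝 (g x)))
    (hle : ∀ k, ∫ x, G k x ∂μ ≤ c k) (hc : Tendsto c atTop (𝓝 a)) :
    Integrable g μ ∧ ∫ x, g x ∂μ ≤ a := by
  have hgm : AEStronglyMeasurable g μ :=
    aestronglyMeasurable_of_tendsto_ae atTop (fun k => (hint k).1) hlim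
  have hg0 : 0 ≤ᵐ[μ] g := by
    filter_upwards [ae_all_iff.2 hpos, hlim] with x hx hl
    exact ge_of_tendsto' hl hx
  have hfat : ∫⁻ x, ENNReal.ofReal (g x) ∂μ ≤ ENNReal.ofReal a := by
    calc ∫⁻ x, ENNReal.ofReal (g x) ∂μ
        = ∫⁻ x, liminf (fun k => ENNReal.ofReal (G k x)) atTop ∂μ := by
          refine lintegral_congr_ae ?_
          filter_upwards [hlim] with x hx
          exact ((ENNReal.continuous_ofReal.tendsto _).comp hx).liminf_eq.symm
      _ ≤ liminf (fun k => ∫⁻ x, ENNReal.ofReal (G k x) ∂μ) atTop :=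
          lintegral_liminf_le' fun k => (hint k).1.aemeasurable.ennreal_ofReal
      _ ≤ liminf (fun k => ENNReal.ofReal (c k)) atTop := by
          refine liminf_le_liminf (Eventually.of_forall fun k => ?_)
          rw [← ofReal_integral_eq_lintegral_ofReal (hint k) (hpos k)]
          exact ENNReal.ofReal_le_ofReal (hle k)
      _ = ENNReal.ofReal a := ((ENNReal.continuous_ofReal.tendsto _).comp hc).liminf_eq
  have ha : 0 ≤ a := ge_of_tendsto' hc fun k => (integral_nonneg_of_ae (hpos k)).trans (hle k)
  refine ⟨⟨hgm, ?_⟩, ?_⟩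
  · rw [hasFiniteIntegral_iff_ofReal hg0]
    exact hfat.trans_lt ENNReal.ofReal_lt_top
  · rw [integral_eq_lintegral_of_nonneg_ae hg0 hgm]
    exact ENNReal.toReal_le_of_le_ofReal ha hfat

lemma exists_ae_bound_of_memLp_top {F : Type*} [NormedAddCommGroup F] {φ : α → F}
    (h : MemLp φ ⊤ μ) : ∃ M, ∀ᵐ x ∂μ, ‖φ x‖ ≤ M := by
  refine ⟨(eLpNorm φ ⊤ μ).toReal, ?_⟩
  filter_upwards [ae_le_eLpNormEssSup (f := φ) (μ := μ)] with x hx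
  rw [← eLpNorm_exponent_top] at hx
  simpa using ENNReal.toReal_mono h.eLpNorm_ne_top hx

end Lp

/-! ### Smooth Lipschitz functions act on H¹₀. -/

section ChainRule

variable {n : ℕ} {Ω : Set (E n)}

lemma dist_le_of_abs_deriv_le {T : ℝ → ℝ} {C : ℝ} (hT : Differentiable ℝ T)
    (hC : ∀ s, |deriv T s| ≤ C) (a b : ℝ) : ‖T a - T b‖ ≤ C * ‖a - b‖ :=
  Convex.norm_image_sub_le_of_norm_deriv_le (s := univ) (fun x _ => hT x) (fun x _ => hC x)
    convex_univ (mem_univ b) (mem_univ a)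

/-- Chain rule in `H¹₀(Ω)`. -/
lemma exists_comp_mem_H10 {T : ℝ → ℝ} {C : ℝ} (hT : ContDiff ℝ (⊤ : ℕ∞) T) (hT0 : T 0 = 0)
    (hC : ∀ s, |deriv T s| ≤ C) {p : L2 Ω × L2Vec Ω} (hp : p ∈ H10 Ω) :
    ∃ q ∈ H10 Ω, (∀ᵐ x ∂volume.restrict Ω, q.1 x = T (p.1 x)) ∧
      ∀ᵐ x ∂volume.restrict Ω, q.2 x = deriv T (p.1 x) • p.2 x := by
  have hTd : Differentiable ℝ T := hT.differentiable (by simp)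
  have hT' : Continuous (deriv T) := hT.continuous_deriv (by simp)
  have hlip := dist_le_of_abs_deriv_le hTd hC
  have m1 : MemLp (fun x => T (p.1 x)) 2 (volume.restrict Ω) := by
    refine (Lp.memLp p.1).of_le_mul
      (hT.continuous.comp_aestronglyMeasurable (Lp.aestronglyMeasurable _)) (c := C) ?_
    refine Eventually.of_forall fun x => ?_
    simpa [hT0] using hlip (p.1 x) 0
  have mk : ∀ {z : E n → ℝ}, AEStronglyMeasurable z (volume.restrict Ω) →
      MemLp (fun x => deriv T (z x) • p.2 x) 2 (volume.restrict Ω) := by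
    intro z hz
    refine (Lp.memLp p.2).of_le_mul
      ((hT'.comp_aestronglyMeasurable hz).smul (Lp.aestronglyMeasurable _)) (c := C) ?_
    refine Eventually.of_forall fun x => ?_
    rw [norm_smul]
    exact mul_le_mul_of_nonneg_right (hC _) (norm_nonneg _)
  have m2 := mk (Lp.aestronglyMeasurable p.1)
  refine ⟨(m1.toLp, m2.toLp), ?_, m1.coeFn_toLp, m2.coeFn_toLp⟩
  obtain ⟨s, hs, hlim⟩ := mem_closure_iff_seq_limit.mp hp
  choose φ h h1 h2 using hs
  have l1 : Tendsto (fun k => (s k).1) atTop (𝓝 p.1) := (continuous_fst.tendsto _).comp hlim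
  have l2 : Tendsto (fun k => (s k).2) atTop (𝓝 p.2) := (continuous_snd.tendsto _).comp hlim
  -- Continuity of `deriv T` only gives pointwise convergence, hence the passage to an almost
  -- everywhere convergent subsequence.
  obtain ⟨ns, hns, hae⟩ := (tendstoInMeasure_of_tendsto_Lp l1).exists_seq_tendsto_ae
  replace l1 := l1.comp hns.tendsto_atTop
  replace l2 := l2.comp hns.tendsto_atTop
  have hc := fun k => (h (ns k)).comp hT hT0
  have hgr : ∀ k x, gradient (fun x => T (φ (ns k) x)) x
      = deriv T (φ (ns k) x) • gradient (φ (ns k)) x := fun k x =>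
    gradient_comp (hTd _) ((h (ns k)).differentiable x)
  refine mem_closure_of_tendsto (b := atTop)
    (f := fun k => ((hc k).memLp.toLp, (hc k).memLp_gradient.toLp)) ?_
    (Eventually.of_forall fun k => (hc k).toLp_mem_testGraph)
  refine Tendsto.prodMk_nhds ?_ ?_
  · rw [tendsto_iff_norm_sub_tendsto_zero] at l1 ⊢
    refine squeeze_zero (fun _ => norm_nonneg _) (fun k => ?_) (by simpa using l1.const_mul C)
    refine Lp.norm_le_mul_norm_of_ae_le_mul ?_
    filter_upwards [Lp.coeFn_sub ((hc k).memLp.toLp : L2 Ω) m1.toLp, (hc k).memLp.coeFn_toLp,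
      m1.coeFn_toLp, Lp.coeFn_sub (s (ns k)).1 p.1, h1 (ns k)] with x x1 x2 x3 x4 x5
    rw [x1, x4, Pi.sub_apply, Pi.sub_apply, x2, x3, x5]
    exact hlip _ _
  -- The intermediate field `T'(φ_k) ∇y` splits the error: it tends to `T'(y) ∇y` by domination, and
  -- differs from `T'(φ_k) ∇φ_k` by at most `C |∇φ_k - ∇y|`.
  · have mb := fun k => mk (h (ns k)).continuous.aestronglyMeasurable
    have lb : Tendsto (fun k => ((mb k).toLp : L2Vec Ω)) atTop (𝓝 m2.toLp) := by
      refine tendsto_L2_of_dominated (w := p.2) (C := 2 * C) (fun k => ?_) ?_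
      · filter_upwards [(mb k).coeFn_toLp, m2.coeFn_toLp] with x x1 x2
        rw [x1, x2, ← sub_smul, norm_smul]
        refine mul_le_mul_of_nonneg_right ?_ (norm_nonneg _)
        refine (norm_sub_le _ _).trans ?_
        have a1 := hC (φ (ns k) x)
        have a2 := hC (p.1 x)
        rw [Real.norm_eq_abs, Real.norm_eq_abs]
        linarith
      · filter_upwards [ae_all_iff.2 fun k => (mb k).coeFn_toLp, m2.coeFn_toLp, hae,
          ae_all_iff.2 fun k => h1 (ns k)] with x x1 x2 x3 x4
        simp only [x1, x2]
        simp only [x4] at x3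
        exact ((hT'.tendsto _).comp x3).smul_const _
    have ld : Tendsto (fun k => ((hc k).memLp_gradient.toLp : L2Vec Ω) - (mb k).toLp) atTop
        (𝓝 0) := by
      rw [tendsto_iff_norm_sub_tendsto_zero] at l2
      rw [tendsto_zero_iff_norm_tendsto_zero]
      refine squeeze_zero (fun _ => norm_nonneg _) (fun k => ?_) (by simpa using l2.const_mul C)
      refine Lp.norm_le_mul_norm_of_ae_le_mul ?_
      filter_upwards [Lp.coeFn_sub ((hc k).memLp_gradient.toLp : L2Vec Ω) (mb k).toLp,
        (hc k).memLp_gradient.coeFn_toLp, (mb k).coeFn_toLp, Lp.coeFn_sub (s (ns k)).2 p.2,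
        h2 (ns k)] with x x1 x2 x3 x4 x5
      rw [x1, x4, Pi.sub_apply, Pi.sub_apply, x2, x3, x5, hgr, ← smul_sub, norm_smul]
      exact mul_le_mul_of_nonneg_right (hC _) (norm_nonneg _)
    simpa using ld.add lb

end ChainRule

/-! ### The weak equation in Hilbert space form. -/

section Reformulation

variable {n : ℕ} {Ω ω : Set (E n)}

/-- Extension by zero of an `L²` function. -/
lemma memLp_indicator_L2 (hω : MeasurableSet ω) (u : L2 ω) :
    MemLp (ω.indicator u) 2 (volume.restrict Ω) :=
  MemLp.restrict Ω ((memLp_indicator_iff_restrict hω).2 (Lp.memLp u))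

lemma inner_toLp_indicator (hω : MeasurableSet ω) (hsub : ω ⊆ Ω) (u : L2 ω) (y : L2 Ω) :
    ⟪((memLp_indicator_L2 hω u).toLp : L2 Ω), y⟫ = ∫ x in ω, u x * y x := by
  have hr : ∫ x in ω, u x * y x = ∫ x in Ω, ω.indicator (fun x => u x * y x) x := by
    rw [integral_indicator hω, Measure.restrict_restrict_of_subset hsub]
  rw [L2.inner_def, hr]
  refine integral_congr_ae ?_
  filter_upwards [(memLp_indicator_L2 (Ω := Ω) hω u).coeFn_toLp] with x hx
  rw [hx]
  by_cases hxω : x ∈ ω <;> simp [hxω, mul_comm]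

lemma integrable_mul_of_ae_bound {μ : Measure (E n)} {a b : E n → ℝ} {M : ℝ} (ha : Integrable a μ)
    (hb : AEStronglyMeasurable b μ) (hM : ∀ᵐ x ∂μ, ‖b x‖ ≤ M) :
    Integrable (fun x => a x * b x) μ := by
  simpa only [mul_comm] using ha.bdd_mul hb hM

/-- The control, extended by zero, becomes an element of L² of the whole domain, and essential
boundedness of a test function becomes an explicit bound `M`. -/
lemma isWeakSolution_iff {f : ℝ → ℝ} (hω : MeasurableSet ω) (hsub : ω ⊆ Ω) {u : L2 ω} {y : L2 Ω} :
    IsWeakSolution f Ω ω u y ↔ ∃ g : L2Vec Ω, (y, g) ∈ H10 Ω ∧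
      Integrable (fun x => f (y x)) (volume.restrict Ω) ∧
      ∀ q ∈ H10 Ω, ∀ M : ℝ, (∀ᵐ x ∂volume.restrict Ω, ‖q.1 x‖ ≤ M) →
        ⟪g, q.2⟫ + ∫ x in Ω, f (y x) * q.1 x = ⟪((memLp_indicator_L2 hω u).toLp : L2 Ω), q.1⟫ := by
  unfold IsWeakSolution
  simp only [memH10_iff, inner_toLp_indicator hω hsub]
  refine exists_congr fun g => and_congr_right fun _ => and_congr_right fun hi => ?_
  have key : ∀ q : L2 Ω × L2Vec Ω, ∀ M : ℝ, (∀ᵐ x ∂volume.restrict Ω, ‖q.1 x‖ ≤ M) →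
      ∫ x in Ω, (⟪g x, q.2 x⟫ + f (y x) * q.1 x) = ⟪g, q.2⟫ + ∫ x in Ω, f (y x) * q.1 x := by
    intro q M hM
    rw [L2.inner_def, integral_add (L2.integrable_inner _ _)]
    exact integrable_mul_of_ae_bound hi (Lp.aestronglyMeasurable _) hM
  constructor
  · intro H q hq M hM
    rw [← key q M hM]
    exact H q.1 q.2 hq (memLp_top_of_bound (Lp.aestronglyMeasurable _) M hM)
  · intro H φ h hφ ht
    obtain ⟨M, hM⟩ := exists_ae_bound_of_memLp_top ht
    rw [← H (φ, h) hφ M hM]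
    exact key (φ, h) M hM

end Reformulation

/-! ### The convex primitive of the nonlinearity. -/

section Primitive

/-- The primitive of `f` vanishing at `0`. -/
noncomputable def primitive (f : ℝ → ℝ) (s : ℝ) : ℝ := ∫ t in (0 : ℝ)..s, f t

variable {f : ℝ → ℝ}

lemma hasDerivAt_primitive (hf : Continuous f) (s : ℝ) : HasDerivAt (primitive f) (f s) s :=
  intervalIntegral.integral_hasDerivAt_right (hf.intervalIntegrable _ _)
    (hf.stronglyMeasurableAtFilter _ _) hf.continuousAt

lemma continuous_primitive (hf : Continuous f) : Continuous (primitive f) :=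
  continuous_iff_continuousAt.2 fun s => (hasDerivAt_primitive hf s).continuousAt

lemma primitive_zero : primitive f 0 = 0 := by simp [primitive]

lemma convexOn_primitive (hf : Continuous f) (hm : Monotone f) :
    ConvexOn ℝ univ (primitive f) := by
  refine Monotone.convexOn_univ_of_deriv
    (fun s => (hasDerivAt_primitive hf s).differentiableAt) ?_
  intro a b hab
  rw [(hasDerivAt_primitive hf a).deriv, (hasDerivAt_primitive hf b).deriv]
  exact hm hab

lemma primitive_convex_comb (hf : Continuous f) (hm : Monotone f) {t : ℝ} (h0 : 0 ≤ t) (h1 : t ≤ 1)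
    (a b : ℝ) :
    primitive f (a + t * (b - a)) ≤ primitive f a + t * (primitive f b - primitive f a) := by
  have := (convexOn_primitive hf hm).2 (mem_univ a) (mem_univ b) (sub_nonneg.2 h1) h0 (by ring)
  simp only [smul_eq_mul] at this
  rw [show a + t * (b - a) = (1 - t) * a + t * b by ring]
  linarith

lemma primitive_nonneg (hm : Monotone f) (h0 : f 0 = 0) (s : ℝ) :
    0 ≤ primitive f s := by
  rcases le_total 0 s with hs | hs
  · exact intervalIntegral.integral_nonneg hs fun t ht => h0 ▸ hm ht.1
  · rw [primitive, intervalIntegral.integral_symm, ← intervalIntegral.integral_neg]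
    exact intervalIntegral.integral_nonneg hs fun t ht => neg_nonneg.2 (h0 ▸ hm ht.2)

end Primitive

/-! ### Minimising the energy, and its variational inequality. -/

section Minimisation

variable {n : ℕ} {Ω : Set (E n)} {f : ℝ → ℝ}

/-- The energy whose Euler–Lagrange equation is the state equation. -/
noncomputable def energy (f : ℝ → ℝ) (U : L2 Ω) (p : L2 Ω × L2Vec Ω) : ℝ :=
  1 / 2 * ‖p.2‖ ^ 2 + (∫ x in Ω, primitive f (p.1 x)) - ⟪U, p.1⟫

/-- The elements of `H¹₀(Ω)` of finite energy. -/
def finiteEnergy (f : ℝ → ℝ) (Ω : Set (E n)) : Set (L2 Ω × L2Vec Ω) :=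
  {p | p ∈ H10 Ω ∧ Integrable (fun x => primitive f (p.1 x)) (volume.restrict Ω)}

lemma integrable_primitive_comb (hf : Continuous f) (hm : Monotone f) (h0 : f 0 = 0) {y v : L2 Ω}
    (hy : Integrable (fun x => primitive f (y x)) (volume.restrict Ω))
    (hv : Integrable (fun x => primitive f (v x)) (volume.restrict Ω)) {t : ℝ} (ht0 : 0 ≤ t)
    (ht1 : t ≤ 1) :
    Integrable (fun x => primitive f (y x + t * (v x - y x))) (volume.restrict Ω) := by
  refine (hy.add ((hv.sub hy).const_mul t)).mono' ?_ (Eventually.of_forall fun x => ?_)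
  · exact (continuous_primitive hf).comp_aestronglyMeasurable ((Lp.aestronglyMeasurable y).add
      (((Lp.aestronglyMeasurable v).sub (Lp.aestronglyMeasurable y)).const_mul t))
  · rw [Real.norm_of_nonneg (primitive_nonneg hm h0 _)]
    exact primitive_convex_comb hf hm ht0 ht1 _ _

lemma coeFn_comb (y v : L2 Ω) (t : ℝ) :
    ∀ᵐ x ∂volume.restrict Ω, (y + t • (v - y)) x = y x + t * (v x - y x) := by
  filter_upwards [Lp.coeFn_add y (t • (v - y)), Lp.coeFn_smul t (v - y), Lp.coeFn_sub v y]
    with x x1 x2 x3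
  rw [x1, Pi.add_apply, x2, Pi.smul_apply, x3, Pi.sub_apply, smul_eq_mul]

lemma comb_mem_finiteEnergy (hf : Continuous f) (hm : Monotone f) (h0 : f 0 = 0)
    {p q : L2 Ω × L2Vec Ω} (hp : p ∈ finiteEnergy f Ω) (hq : q ∈ finiteEnergy f Ω) {t : ℝ}
    (ht0 : 0 ≤ t) (ht1 : t ≤ 1) : p + t • (q - p) ∈ finiteEnergy f Ω := by
  refine ⟨(H10 Ω).add_mem hp.1 ((H10 Ω).smul_mem t ((H10 Ω).sub_mem hq.1 hp.1)), ?_⟩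
  refine (integrable_primitive_comb hf hm h0 hp.2 hq.2 ht0 ht1).congr ?_
  filter_upwards [coeFn_comb p.1 q.1 t] with x hx
  rw [← hx]
  rfl

/-- The parallelogram identity for the gradient term supplies the gain. The primitive is convex and
the last term is linear. -/
lemma energy_midpoint_le (hf : Continuous f) (hm : Monotone f) (h0 : f 0 = 0) (U : L2 Ω)
    {p q : L2 Ω × L2Vec Ω} (hp : p ∈ finiteEnergy f Ω) (hq : q ∈ finiteEnergy f Ω) :
    energy f U (p + (1 / 2 : ℝ) • (q - p)) ≤
      1 / 2 * (energy f U p + energy f U q) - 1 / 8 * ‖p.2 - q.2‖ ^ 2 := by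
  have e1 : ∫ x in Ω, primitive f ((p + (1 / 2 : ℝ) • (q - p)).1 x) ≤
      1 / 2 * ((∫ x in Ω, primitive f (p.1 x)) + ∫ x in Ω, primitive f (q.1 x)) := by
    rw [← integral_add hp.2 hq.2, ← integral_const_mul]
    refine integral_mono_ae (comb_mem_finiteEnergy hf hm h0 hp hq (by norm_num) (by norm_num)).2
      ((hp.2.add hq.2).const_mul _) ?_
    filter_upwards [coeFn_comb p.1 q.1 (1 / 2)] with x hx
    change primitive f ((p.1 + (1 / 2 : ℝ) • (q.1 - p.1)) x) ≤ _
    rw [hx]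
    have := primitive_convex_comb hf hm (by norm_num : (0 : ℝ) ≤ 1 / 2) (by norm_num) (p.1 x) (q.1 x)
    linarith
  have e2 : ‖(p + (1 / 2 : ℝ) • (q - p)).2‖ ^ 2 =
      1 / 2 * (‖p.2‖ ^ 2 + ‖q.2‖ ^ 2) - 1 / 4 * ‖p.2 - q.2‖ ^ 2 := by
    change ‖p.2 + (1 / 2 : ℝ) • (q.2 - p.2)‖ ^ 2 = _
    rw [norm_add_sq_real, norm_sub_sq_real, norm_smul, mul_pow, inner_smul_right, inner_sub_right,
      norm_sub_sq_real, real_inner_self_eq_norm_sq, real_inner_comm p.2 q.2]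
    norm_num
    ring
  have e3 : ⟪U, (p + (1 / 2 : ℝ) • (q - p)).1⟫ = 1 / 2 * (⟪U, p.1⟫ + ⟪U, q.1⟫) := by
    change ⟪U, p.1 + (1 / 2 : ℝ) • (q.1 - p.1)⟫ = _
    rw [inner_add_right, inner_smul_right, inner_sub_right]
    ring
  unfold energy
  rw [e2, e3]
  linarith

lemma zero_mem_finiteEnergy : (0 : L2 Ω × L2Vec Ω) ∈ finiteEnergy f Ω := by
  refine ⟨(H10 Ω).zero_mem, (integrable_zero _ ℝ _).congr ?_⟩
  filter_upwards [Lp.coeFn_zero ℝ 2 (volume.restrict Ω)] with x hx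
  change 0 = primitive f ((0 : L2 Ω) x)
  rw [hx, Pi.zero_apply, primitive_zero]

/-- Existence of a minimiser of the energy: a minimising sequence is a Cauchy sequence. -/
lemma exists_energy_minimiser (hf : Continuous f) (hm : Monotone f) (h0 : f 0 = 0) {C : ℝ}
    (hC : 0 ≤ C) (hpoincare : ∀ p ∈ H10 Ω, ‖p.1‖ ≤ C * ‖p.2‖) (U : L2 Ω) :
    ∃ p ∈ finiteEnergy f Ω, ∀ q ∈ finiteEnergy f Ω, energy f U p ≤ energy f U q := by
  have hFn : ∀ y : L2 Ω, 0 ≤ ∫ x in Ω, primitive f (y x) := fun y =>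
    integral_nonneg fun x => primitive_nonneg hm h0 _
  have hbdd : BddBelow (energy f U '' finiteEnergy f Ω) := by
    -- By Poincaré the energy is at least `g²/2 - C ‖U‖ g` with `g = ‖q.2‖`; the bound is the
    -- minimum of this quadratic.
    refine ⟨-(1 / 2 * (C * ‖U‖) ^ 2), ?_⟩
    rintro _ ⟨q, hq, rfl⟩
    have h1 := (real_inner_le_norm U q.1).trans
      (mul_le_mul_of_nonneg_left (hpoincare q hq.1) (norm_nonneg _))
    have h2 := hFn q.1
    unfold energy
    nlinarith [sq_nonneg (‖q.2‖ - C * ‖U‖)]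
  have hne : (energy f U '' finiteEnergy f Ω).Nonempty := ⟨_, 0, zero_mem_finiteEnergy, rfl⟩
  set I := sInf (energy f U '' finiteEnergy f Ω) with hI
  have hIle : ∀ q ∈ finiteEnergy f Ω, I ≤ energy f U q := fun q hq =>
    csInf_le hbdd (mem_image_of_mem _ hq)
  have hseq : ∀ k : ℕ, ∃ p ∈ finiteEnergy f Ω, energy f U p ≤ I + 1 / (k + 1) := by
    intro k
    obtain ⟨_, ⟨p, hp, rfl⟩, hlt⟩ :=
      exists_lt_of_csInf_lt hne (lt_add_of_pos_right I (Nat.one_div_pos_of_nat (α := ℝ) (n := k)))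
    exact ⟨p, hp, hlt.le⟩
  choose p hp hpE using hseq
  -- The midpoint has energy at least `I`, so the gain `‖·‖²/8` is at most `1/(N+1)`. The factor
  -- `max C 1` covers both components of the sup norm on the product, the first through Poincaré.
  have hdist : ∀ N k l : ℕ, N ≤ k → N ≤ l →
      dist (p k) (p l) ≤ max C 1 * √(8 * (1 / ((N : ℝ) + 1))) := by
    intro N k l hk hl
    have hmid := energy_midpoint_le hf hm h0 U (hp k) (hp l)
    have hmI := hIle _ (comb_mem_finiteEnergy hf hm h0 (hp k) (hp l)
      (by norm_num : (0 : ℝ) ≤ 1 / 2) (by norm_num))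
    have ek := (hpE k).trans (add_le_add_right (Nat.one_div_le_one_div (α := ℝ) hk) I)
    have el := (hpE l).trans (add_le_add_right (Nat.one_div_le_one_div (α := ℝ) hl) I)
    have hg : ‖(p k).2 - (p l).2‖ ≤ √(8 * (1 / ((N : ℝ) + 1))) := by
      refine Real.le_sqrt_of_sq_le ?_
      linarith
    rw [dist_eq_norm, Prod.norm_def]
    have hmax : 0 ≤ max C 1 := hC.trans (le_max_left _ _)
    refine max_le ?_ ?_
    · exact (hpoincare _ ((H10 Ω).sub_mem (hp k).1 (hp l).1)).trans
        (mul_le_mul (le_max_left _ _) hg (norm_nonneg _) hmax)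
    · calc ‖(p k).2 - (p l).2‖ = 1 * ‖(p k).2 - (p l).2‖ := (one_mul _).symm
        _ ≤ _ := mul_le_mul (le_max_right _ _) hg (norm_nonneg _) hmax
  have hto : Tendsto (fun N : ℕ => max C 1 * √(8 * (1 / ((N : ℝ) + 1)))) atTop (𝓝 0) := by
    have := ((tendsto_one_div_add_atTop_nhds_zero_nat (𝕜 := ℝ)).const_mul 8).sqrt.const_mul
      (max C 1)
    simpa using this
  have hcau : CauchySeq p := cauchySeq_of_le_tendsto_0 _ (fun k l N hk hl => hdist N k l hk hl) hto
  obtain ⟨P, hP⟩ := cauchySeq_tendsto_of_complete hcau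
  have hPmem : P ∈ H10 Ω := isClosed_H10.mem_of_tendsto hP (Eventually.of_forall fun k => (hp k).1)
  have l1 : Tendsto (fun k => (p k).1) atTop (𝓝 P.1) := (continuous_fst.tendsto _).comp hP
  have l2 : Tendsto (fun k => (p k).2) atTop (𝓝 P.2) := (continuous_snd.tendsto _).comp hP
  obtain ⟨ns, hns, hae⟩ := (tendstoInMeasure_of_tendsto_Lp l1).exists_seq_tendsto_ae
  -- Here `c` is the bound on the integral of the primitive obtained by solving `energy ≤ I +
  -- 1/(k+1)` for it. All its other terms converge in norm, so Fatou gives finite energy and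
  -- minimality of the limit together.
  have hfat := integrable_and_integral_le_of_tendsto (μ := volume.restrict Ω)
    (G := fun k x => primitive f ((p (ns k)).1 x)) (g := fun x => primitive f (P.1 x))
    (c := fun k => I + 1 / ((ns k : ℝ) + 1) - 1 / 2 * ‖(p (ns k)).2‖ ^ 2 + ⟪U, (p (ns k)).1⟫)
    (a := I + 0 - 1 / 2 * ‖P.2‖ ^ 2 + ⟪U, P.1⟫) (fun k => (hp _).2)
    (fun k => Eventually.of_forall fun x => primitive_nonneg hm h0 _)
    (by filter_upwards [hae] with x hx
        exact ((continuous_primitive hf).tendsto _).comp hx)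
    (fun k => by
      have := hpE (ns k)
      unfold energy at this
      linarith)
    (by
      have t1 := (tendsto_one_div_add_atTop_nhds_zero_nat (𝕜 := ℝ)).comp hns.tendsto_atTop
      have t2 := ((l2.comp hns.tendsto_atTop).norm.pow 2).const_mul (1 / 2 : ℝ)
      have t3 := (tendsto_const_nhds (x := U)).inner (𝕜 := ℝ) (l1.comp hns.tendsto_atTop)
      exact ((t1.const_add I).sub t2).add t3)
  refine ⟨P, ⟨hPmem, hfat.1⟩, fun q hq => le_trans ?_ (hIle q hq)⟩
  have := hfat.2
  unfold energy
  linarith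

/-- The variational inequality satisfied by a minimiser of the energy. -/
lemma variational_inequality (hf : Continuous f) (hm : Monotone f) (h0 : f 0 = 0) {U : L2 Ω}
    {p : L2 Ω × L2Vec Ω} (hp : p ∈ finiteEnergy f Ω)
    (hmin : ∀ q ∈ finiteEnergy f Ω, energy f U p ≤ energy f U q) {q : L2 Ω × L2Vec Ω}
    (hq : q ∈ finiteEnergy f Ω) :
    Integrable (fun x => f (p.1 x) * (p.1 x - q.1 x)) (volume.restrict Ω) ∧
      ∫ x in Ω, f (p.1 x) * (p.1 x - q.1 x) ≤ ⟪p.2, q.2 - p.2⟫ - ⟪U, q.1 - p.1⟫ := by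
  set t : ℕ → ℝ := fun k => 1 / ((k : ℝ) + 1) with ht
  have htpos : ∀ k, 0 < t k := fun k => Nat.one_div_pos_of_nat
  have htle : ∀ k, t k ≤ 1 := fun k => by
    rw [ht]; simp only; rw [div_le_one (by positivity)]; simp
  have htlim : Tendsto t atTop (𝓝 0) := tendsto_one_div_add_atTop_nhds_zero_nat
  have hcomb := fun k => integrable_primitive_comb hf hm h0 hp.2 hq.2 (htpos k).le (htle k)
  have hdiff : Integrable (fun x => primitive f (q.1 x) - primitive f (p.1 x))
      (volume.restrict Ω) := hq.2.sub hp.2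
  have hGi : ∀ k, Integrable (fun x => (t k)⁻¹ * (primitive f (p.1 x) -
      primitive f (p.1 x + t k * (q.1 x - p.1 x))) +
      (primitive f (q.1 x) - primitive f (p.1 x))) (volume.restrict Ω) := fun k =>
    ((hp.2.sub (hcomb k)).const_mul _).add hdiff
  -- Fatou is applied to the negated difference quotients of the primitive along the segment to `q`.
  -- By convexity, adding the increment from `p` to `q` makes them nonnegative, so integrability of
  -- the limit comes without any growth assumption on `f`.
  have hfat := integrable_and_integral_le_of_tendsto (μ := volume.restrict Ω)
    (g := fun x => f (p.1 x) * (p.1 x - q.1 x) + (primitive f (q.1 x) - primitive f (p.1 x)))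
    (c := fun k => ⟪p.2, q.2 - p.2⟫ + t k / 2 * ‖q.2 - p.2‖ ^ 2 - ⟪U, q.1 - p.1⟫ +
      ∫ x in Ω, (primitive f (q.1 x) - primitive f (p.1 x)))
    (a := ⟪p.2, q.2 - p.2⟫ + 0 / 2 * ‖q.2 - p.2‖ ^ 2 - ⟪U, q.1 - p.1⟫ +
      ∫ x in Ω, (primitive f (q.1 x) - primitive f (p.1 x))) hGi
    (fun k => Eventually.of_forall fun x => ?_) (Eventually.of_forall fun x => ?_)
    (fun k => ?_) ?_
  · have hint : Integrable (fun x => f (p.1 x) * (p.1 x - q.1 x)) (volume.restrict Ω) :=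
      (hfat.1.sub hdiff).congr (Eventually.of_forall fun x => by simp)
    refine ⟨hint, ?_⟩
    have := hfat.2
    rw [integral_add hint hdiff] at this
    linarith
  · have := primitive_convex_comb hf hm (htpos k).le (htle k) (p.1 x) (q.1 x)
    have h2 := mul_le_mul_of_nonneg_left this (inv_nonneg.2 (htpos k).le)
    rw [mul_add, ← mul_assoc, inv_mul_cancel₀ (htpos k).ne'] at h2
    simp only [Pi.zero_apply]
    linarith
  · have hd : HasDerivAt (fun s => primitive f (p.1 x + s * (q.1 x - p.1 x)))
        (f (p.1 x) * (q.1 x - p.1 x)) 0 := by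
      have h1 : HasDerivAt (fun s : ℝ => p.1 x + s * (q.1 x - p.1 x)) (q.1 x - p.1 x) 0 := by
        simpa using ((hasDerivAt_id (0 : ℝ)).mul_const (q.1 x - p.1 x)).const_add (p.1 x)
      have h2 := hasDerivAt_primitive hf (p.1 x + 0 * (q.1 x - p.1 x))
      have := h2.comp (0 : ℝ) h1
      rw [zero_mul, add_zero] at this
      exact this
    have hs := hd.tendsto_slope_zero
    have htn : Tendsto t atTop (𝓝[≠] 0) :=
      tendsto_nhdsWithin_iff.2 ⟨htlim, Eventually.of_forall fun k => (htpos k).ne'⟩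
    have := ((hs.comp htn).neg).add_const (primitive f (q.1 x) - primitive f (p.1 x))
    refine (this.congr fun k => ?_).trans (le_of_eq ?_)
    · simp only [Function.comp_apply, zero_add, zero_mul, add_zero, smul_eq_mul]
      ring
    · congr 1
      ring
  · have hE := hmin _ (comb_mem_finiteEnergy hf hm h0 hp hq (htpos k).le (htle k))
    have e1 : ∫ x in Ω, primitive f ((p + t k • (q - p)).1 x) =
        ∫ x in Ω, primitive f (p.1 x + t k * (q.1 x - p.1 x)) := by
      refine integral_congr_ae ?_
      filter_upwards [coeFn_comb p.1 q.1 (t k)] with x hx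
      rw [← hx]
      rfl
    have e2 : ‖(p + t k • (q - p)).2‖ ^ 2 =
        ‖p.2‖ ^ 2 + 2 * t k * ⟪p.2, q.2 - p.2⟫ + t k ^ 2 * ‖q.2 - p.2‖ ^ 2 := by
      change ‖p.2 + t k • (q.2 - p.2)‖ ^ 2 = _
      rw [norm_add_sq_real, norm_smul, mul_pow, inner_smul_right, Real.norm_eq_abs, sq_abs]
      ring
    have e3 : ⟪U, (p + t k • (q - p)).1⟫ = ⟪U, p.1⟫ + t k * ⟪U, q.1 - p.1⟫ := by
      change ⟪U, p.1 + t k • (q.1 - p.1)⟫ = _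
      rw [inner_add_right, inner_smul_right]
    unfold energy at hE
    rw [e1, e2, e3] at hE
    have hsub : Integrable (fun x => (t k)⁻¹ * (primitive f (p.1 x) -
      primitive f (p.1 x + t k * (q.1 x - p.1 x)))) (volume.restrict Ω) :=
      (hp.2.sub (hcomb k)).const_mul _
    rw [integral_add hsub hdiff, integral_const_mul,
      integral_sub hp.2 (hcomb k)]
    refine add_le_add_left ?_ _
    rw [inv_mul_le_iff₀ (htpos k)]
    nlinarith
  · exact (((((htlim.div_const 2).mul_const _).const_add _).sub_const _).add_const _)

/-- This makes bounded elements of H¹₀ admissible competitors. -/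
lemma integrable_primitive_of_ae_bound [IsFiniteMeasure (volume.restrict Ω)] (hf : Continuous f)
    {v : L2 Ω} {M : ℝ} (hM : ∀ᵐ x ∂volume.restrict Ω, ‖v x‖ ≤ M) :
    Integrable (fun x => primitive f (v x)) (volume.restrict Ω) := by
  obtain ⟨K, hK⟩ := (isCompact_Icc (a := -M) (b := M)).exists_bound_of_continuousOn
    (continuous_primitive hf).continuousOn
  refine Integrable.of_bound ((continuous_primitive hf).comp_aestronglyMeasurable
    (Lp.aestronglyMeasurable v)) K ?_
  filter_upwards [hM] with x hx
  exact hK _ (abs_le.1 hx)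

end Minimisation

/-! ### A smooth, bounded, strictly increasing truncation. -/

section Truncation

/-- Smooth truncation at height of order `a`. -/
noncomputable def truncation (a s : ℝ) : ℝ := a * Real.arctan (s / a)

lemma contDiff_truncation (a : ℝ) : ContDiff ℝ (⊤ : ℕ∞) (truncation a) :=
  contDiff_const.mul (Real.contDiff_arctan.comp (contDiff_id.div_const a))

lemma truncation_zero (a : ℝ) : truncation a 0 = 0 := by simp [truncation]

lemma deriv_truncation {a : ℝ} (ha : a ≠ 0) (s : ℝ) :
    deriv (truncation a) s = 1 / (1 + (s / a) ^ 2) := by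
  have h1 := (Real.hasDerivAt_arctan (s / a)).comp s ((hasDerivAt_id s).div_const a)
  have h2 := h1.const_mul a
  refine h2.deriv.trans ?_
  field_simp

lemma deriv_truncation_pos {a : ℝ} (ha : a ≠ 0) (s : ℝ) : 0 < deriv (truncation a) s := by
  rw [deriv_truncation ha]
  positivity

lemma abs_deriv_truncation_le {a : ℝ} (ha : a ≠ 0) (s : ℝ) : |deriv (truncation a) s| ≤ 1 := by
  rw [abs_of_pos (deriv_truncation_pos ha s), deriv_truncation ha, div_le_one (by positivity)]
  nlinarith [sq_nonneg (s / a)]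

lemma abs_truncation_le_abs {a : ℝ} (ha : a ≠ 0) (s : ℝ) : |truncation a s| ≤ |s| := by
  have := dist_le_of_abs_deriv_le ((contDiff_truncation a).differentiable (by simp))
    (abs_deriv_truncation_le ha) s 0
  simpa [truncation_zero] using this

lemma abs_truncation_le {a : ℝ} (ha : 0 < a) (s : ℝ) : |truncation a s| ≤ a * (Real.pi / 2) := by
  rw [truncation, abs_mul, abs_of_pos ha]
  refine mul_le_mul_of_nonneg_left ?_ ha.le
  exact abs_le.2 ⟨(Real.neg_pi_div_two_lt_arctan _).le, (Real.arctan_lt_pi_div_two _).le⟩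

lemma strictMono_truncation {a : ℝ} (ha : a ≠ 0) : StrictMono (truncation a) :=
  strictMono_of_deriv_pos (deriv_truncation_pos ha)

lemma tendsto_truncation (s : ℝ) :
    Tendsto (fun k : ℕ => truncation ((k : ℝ) + 1) s) atTop (𝓝 s) := by
  -- `a * arctan (s / a)` is the difference quotient at `0` of `t ↦ arctan (t * s)` with step `1 /
  -- a`.
  have hd : HasDerivAt (fun t : ℝ => Real.arctan (t * s)) s 0 := by
    have h1 : HasDerivAt (fun t : ℝ => t * s) s 0 := by
      simpa using (hasDerivAt_id (0 : ℝ)).mul_const s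
    have := (Real.hasDerivAt_arctan (0 * s)).comp (0 : ℝ) h1
    rw [zero_mul, zero_pow two_ne_zero, add_zero, div_one, one_mul] at this
    exact this
  have htn : Tendsto (fun k : ℕ => 1 / ((k : ℝ) + 1)) atTop (𝓝[≠] 0) :=
    tendsto_nhdsWithin_iff.2 ⟨tendsto_one_div_add_atTop_nhds_zero_nat,
      Eventually.of_forall fun k => (Nat.one_div_pos_of_nat (α := ℝ) (n := k)).ne'⟩
  refine (hd.tendsto_slope_zero.comp htn).congr fun k => ?_
  simp [truncation, div_eq_inv_mul]

lemma tendsto_deriv_truncation (s : ℝ) :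
    Tendsto (fun k : ℕ => deriv (truncation ((k : ℝ) + 1)) s) atTop (𝓝 1) := by
  have h : ∀ k : ℕ, deriv (truncation ((k : ℝ) + 1)) s = 1 / (1 + (s * (1 / ((k : ℝ) + 1))) ^ 2) :=
    fun k => by rw [deriv_truncation (by positivity)]; ring
  simp only [h]
  have h1 := (tendsto_one_div_add_atTop_nhds_zero_nat (𝕜 := ℝ)).const_mul s
  have h2 := ((h1.pow 2).const_add 1).inv₀ (by simp)
  simpa using h2

end Truncation

/-! ### Solving the weak equation. -/

section Existence

variable {n : ℕ} {Ω : Set (E n)} {f : ℝ → ℝ}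

/-- Elements of `H¹₀(Ω)` are limits of their truncations. -/
lemma exists_truncation_seq {p : L2 Ω × L2Vec Ω} (hp : p ∈ H10 Ω) :
    ∃ q : ℕ → L2 Ω × L2Vec Ω, (∀ k, q k ∈ H10 Ω) ∧
      (∀ k, ∀ᵐ x ∂volume.restrict Ω, (q k).1 x = truncation ((k : ℝ) + 1) (p.1 x)) ∧
      Tendsto (fun k => (q k).1) atTop (𝓝 p.1) ∧ Tendsto (fun k => (q k).2) atTop (𝓝 p.2) := by
  have ha : ∀ k : ℕ, (k : ℝ) + 1 ≠ 0 := fun k => by positivity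
  have := fun k : ℕ => exists_comp_mem_H10 (contDiff_truncation ((k : ℝ) + 1)) (truncation_zero _)
    (abs_deriv_truncation_le (ha k)) hp
  choose q hq h1 h2 using this
  refine ⟨q, hq, h1, ?_, ?_⟩
  · refine tendsto_L2_of_dominated (w := p.1) (C := 2) (fun k => ?_) ?_
    · filter_upwards [h1 k] with x hx
      rw [hx]
      refine (norm_sub_le _ _).trans ?_
      have := abs_truncation_le_abs (ha k) (p.1 x)
      rw [Real.norm_eq_abs, Real.norm_eq_abs]
      linarith
    · filter_upwards [ae_all_iff.2 h1] with x hx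
      simp only [hx]
      exact tendsto_truncation _
  · refine tendsto_L2_of_dominated (w := p.2) (C := 2) (fun k => ?_) ?_
    · filter_upwards [h2 k] with x hx
      rw [hx]
      refine (norm_sub_le _ _).trans ?_
      have := mul_le_mul_of_nonneg_right (abs_deriv_truncation_le (ha k) (p.1 x))
        (norm_nonneg (p.2 x))
      rw [norm_smul, Real.norm_eq_abs]
      linarith
    · filter_upwards [ae_all_iff.2 h2] with x hx
      simp only [hx]
      simpa using (tendsto_deriv_truncation (p.1 x)).smul_const (p.2 x)

/-- `y` with gradient `g` satisfies the weak form of `-Δ y + f(y) = U`. -/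
def SatisfiesWeakEquation (f : ℝ → ℝ) (U : L2 Ω) (p : L2 Ω × L2Vec Ω) : Prop :=
  p ∈ H10 Ω ∧ Integrable (fun x => f (p.1 x)) (volume.restrict Ω) ∧
    ∀ q ∈ H10 Ω, ∀ M : ℝ, (∀ᵐ x ∂volume.restrict Ω, ‖q.1 x‖ ≤ M) →
      ⟪p.2, q.2⟫ + ∫ x in Ω, f (p.1 x) * q.1 x = ⟪U, q.1⟫

/-- The minimiser `p` itself need not be bounded, so `p + q` may have infinite energy. The
competitors are instead a truncation of `p` plus the bounded test function `q`, and the truncation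
level then tends to infinity. -/
lemma exists_satisfiesWeakEquation [IsFiniteMeasure (volume.restrict Ω)] (hf : Continuous f)
    (hm : Monotone f) (h0 : f 0 = 0) {C : ℝ} (hC : 0 ≤ C)
    (hpoincare : ∀ p ∈ H10 Ω, ‖p.1‖ ≤ C * ‖p.2‖) (U : L2 Ω) :
    ∃ p, SatisfiesWeakEquation f U p := by
  obtain ⟨p, hp, hmin⟩ := exists_energy_minimiser hf hm h0 hC hpoincare U
  have hVI := fun q hq => variational_inequality hf hm h0 hp hmin (q := q) hq
  have hfy : Integrable (fun x => f (p.1 x) * p.1 x) (volume.restrict Ω) := by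
    refine (hVI 0 zero_mem_finiteEnergy).1.congr ?_
    filter_upwards [Lp.coeFn_zero ℝ 2 (volume.restrict Ω)] with x hx
    change _ * (_ - (0 : L2 Ω) x) = _
    rw [hx, Pi.zero_apply, sub_zero]
  have hfm : AEStronglyMeasurable (fun x => f (p.1 x)) (volume.restrict Ω) :=
    hf.comp_aestronglyMeasurable (Lp.aestronglyMeasurable _)
  have hfi : Integrable (fun x => f (p.1 x)) (volume.restrict Ω) := by
    -- `|f s| ≤ s f(s) + f 1 - f (-1)`: the first term dominates when `|s| ≥ 1`, the constant when
    -- `|s| ≤ 1`.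
    refine (hfy.add (integrable_const (f 1 - f (-1)))).mono' hfm
      (Eventually.of_forall fun x => ?_)
    simp only [Pi.add_apply, Real.norm_eq_abs]
    have p1 : f 0 ≤ f 1 := hm zero_le_one
    have p2 : f (-1) ≤ f 0 := hm (by norm_num)
    rcases le_total 1 (p.1 x) with h | h
    · have : f 1 ≤ f (p.1 x) := hm h
      rw [abs_of_nonneg (by linarith)]
      nlinarith
    rcases le_total (p.1 x) (-1) with h' | h'
    · have : f (p.1 x) ≤ f (-1) := hm h'
      rw [abs_of_nonpos (by linarith)]
      nlinarith
    · have q1 : f (p.1 x) ≤ f 1 := hm h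
      have q2 : f (-1) ≤ f (p.1 x) := hm h'
      have q3 : 0 ≤ f (p.1 x) * p.1 x := by
        rcases le_total 0 (p.1 x) with h'' | h''
        · exact mul_nonneg (h0 ▸ hm h'') h''
        · exact mul_nonneg_of_nonpos_of_nonpos (h0 ▸ hm h'') h''
      rw [abs_le]
      constructor <;> linarith
  obtain ⟨s, hs, hs1, l1, l2⟩ := exists_truncation_seq hp.1
  -- Since `f(y)` has the sign of `y - T_k(y)`, where `T_k` is the truncation, that contribution is
  -- nonnegative and can be dropped before the limit. Only one inequality results; `-q` supplies the
  -- other.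
  have hle : ∀ q ∈ H10 Ω, ∀ M : ℝ, (∀ᵐ x ∂volume.restrict Ω, ‖q.1 x‖ ≤ M) →
      ⟪U, q.1⟫ ≤ ⟪p.2, q.2⟫ + ∫ x in Ω, f (p.1 x) * q.1 x := by
    intro q hq M hM
    have hfq := integrable_mul_of_ae_bound hfi (Lp.aestronglyMeasurable q.1) hM
    have hk : ∀ k, -(∫ x in Ω, f (p.1 x) * q.1 x) ≤
        ⟪p.2, (s k).2 + q.2 - p.2⟫ - ⟪U, (s k).1 + q.1 - p.1⟫ := by
      intro k
      have hmem : s k + q ∈ finiteEnergy f Ω := by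
        refine ⟨(H10 Ω).add_mem (hs k) hq, integrable_primitive_of_ae_bound hf
          (M := ((k : ℝ) + 1) * (Real.pi / 2) + M) ?_⟩
        filter_upwards [hs1 k, hM, Lp.coeFn_add (s k).1 q.1] with x x1 x2 x3
        change ‖((s k).1 + q.1) x‖ ≤ _
        rw [x3, Pi.add_apply, x1]
        exact (norm_add_le _ _).trans (add_le_add (abs_truncation_le (by positivity) _) x2)
      have hV := hVI _ hmem
      refine le_trans ?_ hV.2
      rw [← integral_neg]
      refine integral_mono_ae hfq.neg hV.1 ?_
      filter_upwards [hs1 k, Lp.coeFn_add (s k).1 q.1] with x x1 x2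
      change -(f (p.1 x) * q.1 x) ≤ f (p.1 x) * (p.1 x - ((s k).1 + q.1) x)
      rw [x2, Pi.add_apply, x1]
      have hb := abs_le.1 (abs_truncation_le_abs (a := (k : ℝ) + 1) (by positivity) (p.1 x))
      have hpos : 0 ≤ f (p.1 x) * (p.1 x - truncation ((k : ℝ) + 1) (p.1 x)) := by
        rcases le_total 0 (p.1 x) with h | h
        · rw [abs_of_nonneg h] at hb
          exact mul_nonneg (h0 ▸ hm h) (by linarith)
        · rw [abs_of_nonpos h] at hb
          exact mul_nonneg_of_nonpos_of_nonpos (h0 ▸ hm h) (by linarith)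
      nlinarith
    have hlim : Tendsto (fun k => ⟪p.2, (s k).2 + q.2 - p.2⟫ - ⟪U, (s k).1 + q.1 - p.1⟫) atTop
        (𝓝 (⟪p.2, p.2 + q.2 - p.2⟫ - ⟪U, p.1 + q.1 - p.1⟫)) :=
      (tendsto_const_nhds.inner ((l2.add_const _).sub_const _)).sub
        (tendsto_const_nhds.inner ((l1.add_const _).sub_const _))
    have := ge_of_tendsto' hlim hk
    rw [add_sub_cancel_left, add_sub_cancel_left] at this
    linarith
  refine ⟨p, hp.1, hfi, fun q hq M hM => le_antisymm ?_ (hle q hq M hM)⟩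
  have hneg := hle (-q) ((H10 Ω).neg_mem hq) M (by
    filter_upwards [hM, Lp.coeFn_neg q.1] with x x1 x2
    change ‖(-q.1) x‖ ≤ M
    rwa [x2, Pi.neg_apply, norm_neg])
  have e1 : ∫ x in Ω, f (p.1 x) * (-q).1 x = - ∫ x in Ω, f (p.1 x) * q.1 x := by
    rw [← integral_neg]
    refine integral_congr_ae ?_
    filter_upwards [Lp.coeFn_neg q.1] with x x2
    change _ * (-q.1) x = _
    rw [x2, Pi.neg_apply, mul_neg]
  rw [e1, Prod.fst_neg, Prod.snd_neg, inner_neg_right, inner_neg_right] at hneg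
  linarith

lemma inner_smul_self_nonneg {a : E n → ℝ} {u v : L2Vec Ω} (ha : ∀ x, 0 ≤ a x)
    (h : ∀ᵐ x ∂volume.restrict Ω, v x = a x • u x) : 0 ≤ ⟪u, v⟫ := by
  rw [L2.inner_def]
  refine integral_nonneg_of_ae ?_
  filter_upwards [h] with x hx
  rw [hx, inner_smul_right, real_inner_self_eq_norm_sq]
  exact mul_nonneg (ha x) (sq_nonneg _)

/-- Both factors have the sign of `s - t`. It serves to compare two states, and to compare a state
with the constant `1`. -/
lemma mul_truncation_sub_nonneg (hm : Monotone f) {a : ℝ} (ha : a ≠ 0) (s t : ℝ) :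
    0 ≤ (f s - f t) * truncation a (s - t) := by
  rcases le_total s t with h | h
  · refine mul_nonneg_of_nonpos_of_nonpos (sub_nonpos.2 (hm h)) ?_
    rw [← truncation_zero a]
    exact (strictMono_truncation ha).monotone (sub_nonpos.2 h)
  · refine mul_nonneg (sub_nonneg.2 (hm h)) ?_
    rw [← truncation_zero a]
    exact (strictMono_truncation ha).monotone (sub_nonneg.2 h)

lemma eq_of_mul_truncation_sub_eq_zero (hm : StrictMono f) {a s t : ℝ} (ha : a ≠ 0)
    (h : (f s - f t) * truncation a (s - t) = 0) : s = t := by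
  rcases mul_eq_zero.1 h with h | h
  · exact hm.injective (sub_eq_zero.1 h)
  · rw [← truncation_zero a] at h
    exact sub_eq_zero.1 ((strictMono_truncation ha).injective h)

/-- The difference of two solutions may be unbounded, so the equations are tested with its
truncation. The gradient and monotonicity terms are then both nonnegative with sum zero, and strict
monotonicity concludes. -/
lemma SatisfiesWeakEquation.unique (hm : StrictMono f) {U : L2 Ω} {p q : L2 Ω × L2Vec Ω}
    (hp : SatisfiesWeakEquation f U p) (hq : SatisfiesWeakEquation f U q) : p.1 = q.1 := by
  obtain ⟨w, hw, w1, w2⟩ := exists_comp_mem_H10 (contDiff_truncation 1) (truncation_zero _)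
    (abs_deriv_truncation_le one_ne_zero) ((H10 Ω).sub_mem hp.1 hq.1)
  have hb : ∀ᵐ x ∂volume.restrict Ω, ‖w.1 x‖ ≤ 1 * (Real.pi / 2) := by
    filter_upwards [w1] with x hx
    rw [hx]
    exact abs_truncation_le one_pos _
  have ep := hp.2.2 w hw _ hb
  have eq := hq.2.2 w hw _ hb
  have ip := integrable_mul_of_ae_bound hp.2.1 (Lp.aestronglyMeasurable w.1) hb
  have iq := integrable_mul_of_ae_bound hq.2.1 (Lp.aestronglyMeasurable w.1) hb
  have w1' : ∀ᵐ x ∂volume.restrict Ω, w.1 x = truncation 1 (p.1 x - q.1 x) := by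
    filter_upwards [w1, Lp.coeFn_sub p.1 q.1] with x x1 x2
    rw [x1]
    change truncation 1 ((p.1 - q.1) x) = _
    rw [x2, Pi.sub_apply]
  have hnn : 0 ≤ ⟪p.2 - q.2, w.2⟫ :=
    inner_smul_self_nonneg (fun x => (deriv_truncation_pos one_ne_zero _).le) w2
  rw [inner_sub_left] at hnn
  have hpos : 0 ≤ᵐ[volume.restrict Ω] fun x => f (p.1 x) * w.1 x - f (q.1 x) * w.1 x := by
    filter_upwards [w1'] with x hx
    rw [hx, ← sub_mul]
    exact mul_truncation_sub_nonneg hm.monotone one_ne_zero _ _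
  have hint : ∫ x in Ω, (f (p.1 x) * w.1 x - f (q.1 x) * w.1 x) = 0 := by
    refine le_antisymm ?_ (integral_nonneg_of_ae hpos)
    rw [integral_sub ip iq]
    linarith
  have hz := (integral_eq_zero_iff_of_nonneg_ae hpos (ip.sub iq)).1 hint
  refine Lp.ext ?_
  filter_upwards [hz, w1'] with x x1 x2
  refine eq_of_mul_truncation_sub_eq_zero hm one_ne_zero (a := 1) ?_
  rw [sub_mul, ← x2]
  exact x1

end Existence

/-! ### Well-posedness of the state equation. -/

section States

variable {n : ℕ} {r R : ℝ} {f : ℝ → ℝ}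

lemma isWeakSolution_iff_exists {Ω ω : Set (E n)} (hω : MeasurableSet ω) (hsub : ω ⊆ Ω) {u : L2 ω}
    {y : L2 Ω} : IsWeakSolution f Ω ω u y ↔
      ∃ g : L2Vec Ω, SatisfiesWeakEquation f (memLp_indicator_L2 hω u).toLp (y, g) :=
  isWeakSolution_iff hω hsub

/-- Existence and uniqueness of the state. -/
lemma existsUnique_isWeakSolution (hn : 1 ≤ n) (hrR : r ≤ R) (hR : 0 ≤ R)
    (hf : Continuous f) (hm : StrictMono f) (h0 : f 0 = 0) (u : L2 (B n r)) :
    ∃! y : L2 (B n R), IsWeakSolution f (B n R) (B n r) u y := by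
  have hsub : B n r ⊆ B n R := Metric.ball_subset_ball hrR
  have : IsFiniteMeasure (volume.restrict (B n R)) :=
    isFiniteMeasure_restrict.2 measure_ball_lt_top.ne
  obtain ⟨p, hp⟩ := exists_satisfiesWeakEquation hf hm.monotone h0 (by positivity : 0 ≤ 2 * R)
    (fun p hp => norm_fst_le_of_mem_H10 hn subset_rfl measurableSet_ball hR hp)
    (memLp_indicator_L2 measurableSet_ball u).toLp
  refine ⟨p.1, (isWeakSolution_iff_exists measurableSet_ball hsub).2 ⟨p.2, hp⟩, fun y hy => ?_⟩
  obtain ⟨g, hg⟩ := (isWeakSolution_iff_exists measurableSet_ball hsub).1 hy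
  exact hg.unique hm hp

end States

/-! ### Tracking functionals on abstract Hilbert spaces. -/

section Tracking

variable {V H : Type*} [NormedAddCommGroup V] [InnerProductSpace ℝ V] [NormedAddCommGroup H]
  [InnerProductSpace ℝ H]

lemma norm_sq_convex_comb_le {a b : ℝ} (ha : 0 ≤ a) (hb : 0 ≤ b) (hab : a + b = 1) (s t : H) :
    ‖a • s + b • t‖ ^ 2 ≤ a * ‖s‖ ^ 2 + b * ‖t‖ ^ 2 := by
  have h := (convexOn_univ_norm (E := H)).pow (fun _ _ => norm_nonneg _) 2
  simpa using h.2 (mem_univ s) (mem_univ t) ha hb hab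

/-- A tracking functional along an affine map is convex. -/
lemma convexOn_tracking {β : ℝ} (hβ : 0 ≤ β) {Y : V → H}
    (hY : ∀ (u v : V) (a b : ℝ), Y (a • u + b • v) = a • Y u + b • Y v) (z : H) :
    ConvexOn ℝ univ fun u => 1 / 2 * ‖u‖ ^ 2 + β / 2 * ‖Y u - z‖ ^ 2 := by
  refine ⟨convex_univ, fun u _ v _ a b ha hb hab => ?_⟩
  have h1 := norm_sq_convex_comb_le ha hb hab u v
  have h2 := norm_sq_convex_comb_le ha hb hab (Y u - z) (Y v - z)
  have e : Y (a • u + b • v) - z = a • (Y u - z) + b • (Y v - z) := by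
    rw [hY, smul_sub, smul_sub, sub_add_sub_comm, ← add_smul, hab, one_smul]
  simp only [smul_eq_mul]
  rw [e]
  have h3 := mul_le_mul_of_nonneg_left h2 (by positivity : 0 ≤ β / 2)
  linarith

/-- If the tracking functional is convex for every target, the underlying map is affine. -/
lemma map_convex_comb_of_forall_convexOn {β : ℝ} (hβ : 0 < β) {Y : V → H}
    (h : ∀ z, ConvexOn ℝ univ fun u => 1 / 2 * ‖u‖ ^ 2 + β / 2 * ‖Y u - z‖ ^ 2) (u v : V) {a b : ℝ}
    (ha : 0 ≤ a) (hb : 0 ≤ b) (hab : a + b = 1) : Y (a • u + b • v) = a • Y u + b • Y v := by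
  set w := a • u + b • v with hw
  set D := Y w - (a • Y u + b • Y v) with hD
  set K := (1 / 2 * ‖w‖ ^ 2 + β / 2 * ‖Y w‖ ^ 2) - a * (1 / 2 * ‖u‖ ^ 2 + β / 2 * ‖Y u‖ ^ 2)
    - b * (1 / 2 * ‖v‖ ^ 2 + β / 2 * ‖Y v‖ ^ 2) with hK
  have hDD : ⟪Y w, D⟫ - a * ⟪Y u, D⟫ - b * ⟪Y v, D⟫ = ‖D‖ ^ 2 := by
    rw [← real_inner_self_eq_norm_sq]
    nth_rewrite 4 [hD]
    rw [inner_sub_left, inner_add_left, inner_smul_left, inner_smul_left]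
    simp only [conj_trivial]
    ring
  -- For the target `-t D` the terms in `t²` cancel because `a + b = 1`, and the convexity defect is
  -- affine in `t` with slope `β ‖D‖²`. A large `t` violates convexity unless `D = 0`.
  have key : ∀ t : ℝ, K + β * t * ‖D‖ ^ 2 ≤ 0 := by
    intro t
    have hc := (h (-(t • D))).2 (mem_univ u) (mem_univ v) ha hb hab
    simp only [smul_eq_mul, sub_neg_eq_add, ← hw] at hc
    simp only [norm_add_sq_real, inner_smul_right] at hc
    rw [← hDD, hK]
    have hb' : b = 1 - a := by linarith
    subst hb'
    linarith
  by_contra hne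
  have hDpos : 0 < ‖D‖ ^ 2 := by
    have : D ≠ 0 := fun h0 => hne (sub_eq_zero.1 h0)
    positivity
  have := key ((|K| + 1) / (β * ‖D‖ ^ 2))
  rw [mul_assoc, div_mul_eq_mul_div, mul_div_assoc', mul_comm β, mul_assoc,
    mul_comm (‖D‖ ^ 2) β, mul_div_assoc, div_self (by positivity), mul_one] at this
  linarith [neg_abs_le K]

/-- Segments from `0` handle factors in `[0, 1]`, inversion handles larger ones, and the midpoint of
`u` and `-u` handles signs. -/
lemma map_smul_of_map_convex_comb {Y : V → H} (h0 : Y 0 = 0)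
    (h : ∀ (u v : V) (a b : ℝ), 0 ≤ a → 0 ≤ b → a + b = 1 → Y (a • u + b • v) = a • Y u + b • Y v)
    (t : ℝ) (u : V) : Y (t • u) = t • Y u := by
  have small : ∀ t : ℝ, 0 ≤ t → t ≤ 1 → ∀ u, Y (t • u) = t • Y u := by
    intro t h1 h2 u
    have := h u 0 t (1 - t) h1 (by linarith) (by ring)
    simpa [h0] using this
  have pos : ∀ t : ℝ, 0 ≤ t → ∀ u, Y (t • u) = t • Y u := by
    intro t h1 u
    rcases le_total t 1 with h2 | h2
    · exact small t h1 h2 u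
    · have ht : t ≠ 0 := by positivity
      have := small t⁻¹ (by positivity) (inv_le_one_of_one_le₀ h2) (t • u)
      rw [smul_smul, inv_mul_cancel₀ ht, one_smul] at this
      rw [this, smul_smul, mul_inv_cancel₀ ht, one_smul]
  have neg : ∀ u, Y (-u) = -Y u := by
    intro u
    have := h u (-u) (1 / 2) (1 / 2) (by norm_num) (by norm_num) (by norm_num)
    rw [← smul_add, add_neg_cancel, smul_zero, h0, ← smul_add, eq_comm,
      smul_eq_zero_iff_right (by norm_num)] at this
    exact (neg_eq_of_add_eq_zero_right this).symm
  rcases le_total 0 t with ht | ht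
  · exact pos t ht u
  · have := pos (-t) (by linarith) u
    rw [neg_smul, neg, neg_smul] at this
    exact neg_injective this

end Tracking

/-! ### The cost as a tracking functional of the observation. -/

section Cost

variable {n : ℕ} {r R β : ℝ} {f : ℝ → ℝ}

/-- Restriction of an `L²` function to a subset. -/
noncomputable def restrictL2 {A Ω : Set (E n)} (h : A ⊆ Ω) (y : L2 Ω) : L2 A :=
  ((Lp.memLp y).mono_measure (Measure.restrict_mono h le_rfl)).toLp

lemma coeFn_restrictL2 {A Ω : Set (E n)} (h : A ⊆ Ω) (y : L2 Ω) :
    restrictL2 h y =ᵐ[volume.restrict A] y :=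
  MemLp.coeFn_toLp _

lemma restrictL2_comb {A Ω : Set (E n)} (h : A ⊆ Ω) (a b : ℝ) (y w : L2 Ω) :
    restrictL2 h (a • y + b • w) = a • restrictL2 h y + b • restrictL2 h w := by
  have hle : volume.restrict A ≤ volume.restrict Ω := Measure.restrict_mono h le_rfl
  refine Lp.ext ?_
  filter_upwards [coeFn_restrictL2 h (a • y + b • w), coeFn_restrictL2 h y, coeFn_restrictL2 h w,
    ae_mono hle (Lp.coeFn_add (a • y) (b • w)), ae_mono hle (Lp.coeFn_smul a y),
    ae_mono hle (Lp.coeFn_smul b w), Lp.coeFn_add (a • restrictL2 h y) (b • restrictL2 h w),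
    Lp.coeFn_smul a (restrictL2 h y), Lp.coeFn_smul b (restrictL2 h w)]
    with x x1 x2 x3 x4 x5 x6 x7 x8 x9
  rw [x1, x4, Pi.add_apply, x5, x6, x7, Pi.add_apply, x8, x9]
  simp only [Pi.smul_apply, x2, x3]

/-- The observation of the state outside of the control domain. -/
noncomputable def observation (f : ℝ → ℝ) (R r : ℝ) (u : L2 (B n r)) : L2 (B n R \ B n r) :=
  restrictL2 sdiff_subset (state f R r u)

lemma J_eq (z : L2 (B n R \ B n r)) (u : L2 (B n r)) :
    J f R r β z u = 1 / 2 * ‖u‖ ^ 2 + β / 2 * ‖observation f R r u - z‖ ^ 2 := by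
  rw [J, norm_sq_L2, norm_sq_L2]
  simp only [Real.norm_eq_abs]
  congr 2
  refine integral_congr_ae ?_
  filter_upwards [Lp.coeFn_sub (observation f R r u) z,
    coeFn_restrictL2 sdiff_subset (state f R r u)] with x x1 x2
  rw [x1, Pi.sub_apply, observation, x2]

lemma toLp_indicator_comb {Ω ω : Set (E n)} (hω : MeasurableSet ω) (a b : ℝ) (u v : L2 ω) :
    ((memLp_indicator_L2 hω (a • u + b • v)).toLp : L2 Ω) =
      a • (memLp_indicator_L2 hω u).toLp + b • (memLp_indicator_L2 hω v).toLp := by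
  have h1 : ∀ᵐ x ∂volume.restrict ω, (a • u + b • v) x = a * u x + b * v x := by
    filter_upwards [Lp.coeFn_add (a • u) (b • v), Lp.coeFn_smul a u, Lp.coeFn_smul b v]
      with x x1 x2 x3
    rw [x1, Pi.add_apply, x2, x3]
    rfl
  rw [ae_restrict_iff' hω] at h1
  refine Lp.ext ?_
  filter_upwards [(memLp_indicator_L2 (Ω := Ω) hω (a • u + b • v)).coeFn_toLp,
    (memLp_indicator_L2 (Ω := Ω) hω u).coeFn_toLp, (memLp_indicator_L2 (Ω := Ω) hω v).coeFn_toLp,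
    Lp.coeFn_add (a • ((memLp_indicator_L2 hω u).toLp : L2 Ω))
      (b • ((memLp_indicator_L2 hω v).toLp : L2 Ω)),
    Lp.coeFn_smul a ((memLp_indicator_L2 hω u).toLp : L2 Ω),
    Lp.coeFn_smul b ((memLp_indicator_L2 hω v).toLp : L2 Ω), ae_restrict_of_ae h1]
    with x x1 x2 x3 x4 x5 x6 x7
  rw [x1, x4, Pi.add_apply, x5, x6, Pi.smul_apply, Pi.smul_apply, x2, x3]
  by_cases hx : x ∈ ω
  · simp only [indicator_of_mem hx, x7 hx, smul_eq_mul]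
  · simp [hx]

lemma SatisfiesWeakEquation.comb {Ω : Set (E n)} (hf : IsLinearMap ℝ f) {U W : L2 Ω}
    {p q : L2 Ω × L2Vec Ω} (hp : SatisfiesWeakEquation f U p) (hq : SatisfiesWeakEquation f W q)
    (a b : ℝ) : SatisfiesWeakEquation f (a • U + b • W) (a • p + b • q) := by
  have hfx : ∀ᵐ x ∂volume.restrict Ω, f ((a • p + b • q).1 x) = a * f (p.1 x) + b * f (q.1 x) := by
    filter_upwards [Lp.coeFn_add (a • p.1) (b • q.1), Lp.coeFn_smul a p.1, Lp.coeFn_smul b q.1]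
      with x x1 x2 x3
    change f ((a • p.1 + b • q.1) x) = _
    rw [x1, Pi.add_apply, x2, x3, hf.map_add, Pi.smul_apply, Pi.smul_apply, hf.map_smul,
      hf.map_smul, smul_eq_mul, smul_eq_mul]
  refine ⟨(H10 Ω).add_mem ((H10 Ω).smul_mem a hp.1) ((H10 Ω).smul_mem b hq.1), ?_, ?_⟩
  · exact ((hp.2.1.const_mul a).add (hq.2.1.const_mul b)).congr
      (by filter_upwards [hfx] with x hx using hx.symm)
  · intro w hw M hM
    have ep := hp.2.2 w hw M hM
    have eq := hq.2.2 w hw M hM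
    have ip := integrable_mul_of_ae_bound hp.2.1 (Lp.aestronglyMeasurable w.1) hM
    have iq := integrable_mul_of_ae_bound hq.2.1 (Lp.aestronglyMeasurable w.1) hM
    have e : ∫ x in Ω, f ((a • p + b • q).1 x) * w.1 x =
        a * (∫ x in Ω, f (p.1 x) * w.1 x) + b * ∫ x in Ω, f (q.1 x) * w.1 x := by
      rw [← integral_const_mul, ← integral_const_mul,
        ← integral_add (ip.const_mul a) (iq.const_mul b)]
      refine integral_congr_ae ?_
      filter_upwards [hfx] with x hx
      rw [hx]
      ring
    rw [e]
    change ⟪a • p.2 + b • q.2, w.2⟫ + _ = _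
    rw [inner_add_left, inner_smul_left, inner_smul_left, inner_add_left, inner_smul_left,
      inner_smul_left]
    simp only [conj_trivial]
    linear_combination a * ep + b * eq

lemma isWeakSolution_state (h : ∀ u : L2 (B n r),
      ∃! y : L2 (B n R), IsWeakSolution f (B n R) (B n r) u y) (u : L2 (B n r)) :
    IsWeakSolution f (B n R) (B n r) u (state f R r u) := by
  have hex := (h u).exists
  rw [state, dif_pos hex]
  exact hex.choose_spec

lemma exists_satisfiesWeakEquation_state (hrR : r ≤ R) (h : ∀ u : L2 (B n r),
      ∃! y : L2 (B n R), IsWeakSolution f (B n R) (B n r) u y) (u : L2 (B n r)) :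
    ∃ g : L2Vec (B n R), SatisfiesWeakEquation f
      (memLp_indicator_L2 measurableSet_ball u).toLp (state f R r u, g) :=
  (isWeakSolution_iff_exists measurableSet_ball (Metric.ball_subset_ball hrR)).1
    (isWeakSolution_state h u)

lemma state_comb (hrR : r ≤ R) (h : ∀ u : L2 (B n r),
      ∃! y : L2 (B n R), IsWeakSolution f (B n R) (B n r) u y) (hf : IsLinearMap ℝ f)
    (u v : L2 (B n r)) (a b : ℝ) :
    state f R r (a • u + b • v) = a • state f R r u + b • state f R r v := by
  obtain ⟨g, hg⟩ := exists_satisfiesWeakEquation_state hrR h u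
  obtain ⟨k, hk⟩ := exists_satisfiesWeakEquation_state hrR h v
  refine (h (a • u + b • v)).unique (isWeakSolution_state h _) ?_
  rw [isWeakSolution_iff_exists measurableSet_ball (Metric.ball_subset_ball hrR),
    toLp_indicator_comb measurableSet_ball]
  exact ⟨a • g + b • k, hg.comb hf hk a b⟩

lemma convexOn_J_of_isLinearMap (hrR : r ≤ R) (hβ : 0 ≤ β) (h : ∀ u : L2 (B n r),
      ∃! y : L2 (B n R), IsWeakSolution f (B n R) (B n r) u y) (hf : IsLinearMap ℝ f)
    (z : L2 (B n R \ B n r)) : ConvexOn ℝ univ (J f R r β z) := by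
  have e : J f R r β z = fun u => 1 / 2 * ‖u‖ ^ 2 + β / 2 * ‖observation f R r u - z‖ ^ 2 :=
    funext fun u => J_eq z u
  rw [e]
  refine convexOn_tracking hβ (fun u v a b => ?_) z
  rw [observation, state_comb hrR h hf, restrictL2_comb]
  rfl

lemma state_zero (hrR : r ≤ R) (h : ∀ u : L2 (B n r),
      ∃! y : L2 (B n R), IsWeakSolution f (B n R) (B n r) u y) (h0 : f 0 = 0) :
    state f R r (0 : L2 (B n r)) = 0 := by
  refine (h 0).unique (isWeakSolution_state h 0) ?_
  rw [isWeakSolution_iff_exists measurableSet_ball (Metric.ball_subset_ball hrR)]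
  have hU : ((memLp_indicator_L2 measurableSet_ball (0 : L2 (B n r))).toLp : L2 (B n R)) = 0 := by
    have := toLp_indicator_comb (Ω := B n R) measurableSet_ball 0 0 (0 : L2 (B n r)) 0
    simpa only [zero_smul, add_zero] using this
  have hz : ∀ᵐ x ∂volume.restrict (B n R), f ((0 : L2 (B n R)) x) = 0 := by
    filter_upwards [Lp.coeFn_zero ℝ 2 (volume.restrict (B n R))] with x hx
    rw [hx, Pi.zero_apply, h0]
  refine ⟨0, (H10 _).zero_mem, (integrable_zero _ ℝ _).congr ?_, fun q _ M _ => ?_⟩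
  · filter_upwards [hz] with x hx using hx.symm
  · rw [hU]
    have : ∫ x in B n R, f ((0 : L2 (B n R)) x) * q.1 x = 0 := by
      rw [← integral_zero (E n) ℝ]
      refine integral_congr_ae ?_
      filter_upwards [hz] with x hx
      rw [hx, zero_mul]
    rw [this]
    simp

lemma observation_smul_of_forall_convexOn (hrR : r ≤ R) (hβ : 0 < β) (h : ∀ u : L2 (B n r),
      ∃! y : L2 (B n R), IsWeakSolution f (B n R) (B n r) u y) (h0 : f 0 = 0)
    (hJ : ∀ z : L2 (B n R \ B n r), ConvexOn ℝ univ (J f R r β z)) (t : ℝ) (u : L2 (B n r)) :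
    observation f R r (t • u) = t • observation f R r u := by
  refine map_smul_of_map_convex_comb (Y := observation f R r) ?_ (fun u v a b ha hb hab => ?_) t u
  · rw [observation, state_zero hrR h h0]
    have := restrictL2_comb (sdiff_subset : B n R \ B n r ⊆ B n R) 0 0 0 0
    simpa only [zero_smul, add_zero] using this
  · refine map_convex_comb_of_forall_convexOn hβ (fun z => ?_) u v ha hb hab
    have e : J f R r β z = fun u => 1 / 2 * ‖u‖ ^ 2 + β / 2 * ‖observation f R r u - z‖ ^ 2 :=
      funext fun u => J_eq z u
    rw [← e]
    exact hJ z

end Cost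

/-! ### Local consequences of the equation on open sets. -/

section Locality

variable {n : ℕ} {Ω O : Set (E n)} {f : ℝ → ℝ}

/-- The weak gradient vanishes on open sets where the function vanishes. -/
lemma ae_gradient_eq_zero_of_ae_eq_zero [IsFiniteMeasure (volume.restrict Ω)] (hO : IsOpen O)
    (hsub : O ⊆ Ω) {p : L2 Ω × L2Vec Ω} (hp : p ∈ H10 Ω)
    (hz : ∀ᵐ x ∂volume.restrict Ω, x ∈ O → p.1 x = 0) :
    ∀ᵐ x ∂volume.restrict Ω, x ∈ O → p.2 x = 0 := by
  have hint : IntegrableOn p.2 Ω volume := (Lp.memLp p.2).integrable (by norm_num)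
  refine ae_restrict_of_ae (hO.ae_eq_zero_of_integral_contDiff_smul_eq_zero
    (hint.mono_set hsub).locallyIntegrableOn fun φ h1 h2 h3 => ?_)
  have hφ : IsTestFunction O φ := ⟨h1, h2, h3⟩
  rw [← setIntegral_eq_integral_of_forall_compl_eq_zero (s := Ω) fun x hx => by
    rw [(hφ.mono hsub).eq_zero hx, zero_smul]]
  have hw := hasWeakGradient_of_mem_H10 hp φ (hφ.mono hsub)
  rw [← neg_eq_zero, ← hw, ← integral_zero (E n) (E n)]
  refine integral_congr_ae ?_
  filter_upwards [hz] with x hx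
  by_cases hxO : x ∈ O
  · rw [hx hxO, zero_smul]
  · rw [hφ.gradient_eq_zero hxO, smul_zero]

/-- Where a multiple of a state is itself a state and both controls vanish, the nonlinearity is
homogeneous along the state. -/
lemma SatisfiesWeakEquation.ae_homogeneous [IsFiniteMeasure (volume.restrict Ω)] (hO : IsOpen O)
    (hsub : O ⊆ Ω) {U W : L2 Ω} {p q : L2 Ω × L2Vec Ω} (hp : SatisfiesWeakEquation f U p)
    (hq : SatisfiesWeakEquation f W q) (hU : ∀ᵐ x ∂volume.restrict Ω, x ∈ O → U x = 0)
    (hW : ∀ᵐ x ∂volume.restrict Ω, x ∈ O → W x = 0) {t : ℝ}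
    (ht : ∀ᵐ x ∂volume.restrict Ω, x ∈ O → q.1 x = t * p.1 x) :
    ∀ᵐ x ∂volume.restrict Ω, x ∈ O → f (t * p.1 x) = t * f (p.1 x) := by
  -- On `O` the gradient of `q` is thus `t` times that of `p`, so the diffusion terms cancel when
  -- `t` times the first equation is subtracted from the second.
  have hg := ae_gradient_eq_zero_of_ae_eq_zero hO hsub
    ((H10 Ω).sub_mem hq.1 ((H10 Ω).smul_mem t hp.1)) (by
      filter_upwards [ht, Lp.coeFn_sub q.1 (t • p.1), Lp.coeFn_smul t p.1] with x x1 x2 x3 hx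
      change (q.1 - t • p.1) x = 0
      rw [x2, Pi.sub_apply, x3, x1 hx, Pi.smul_apply, smul_eq_mul, sub_self])
  have hi : IntegrableOn (fun x => f (q.1 x) - t * f (p.1 x)) Ω volume :=
    hq.2.1.sub (hp.2.1.const_mul t)
  have hz : ∀ᵐ x, x ∈ O → f (q.1 x) - t * f (p.1 x) = 0 := by
    refine hO.ae_eq_zero_of_integral_contDiff_smul_eq_zero
      (hi.mono_set hsub).locallyIntegrableOn fun φ h1 h2 h3 => ?_
    have hφO : IsTestFunction O φ := ⟨h1, h2, h3⟩
    have hφ := hφO.mono hsub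
    rw [← setIntegral_eq_integral_of_forall_compl_eq_zero (s := Ω) fun x hx => by
      rw [hφ.eq_zero hx, zero_smul]]
    obtain ⟨M, hM'⟩ := exists_ae_bound_of_memLp_top hφ.memLp_top
    have hM : ∀ᵐ x ∂volume.restrict Ω, ‖(hφ.memLp.toLp : L2 Ω) x‖ ≤ M := by
      filter_upwards [hM', hφ.memLp.coeFn_toLp] with x x1 x2
      rwa [x2]
    have ep := hp.2.2 _ hφ.toLp_mem_H10 M hM
    have eq := hq.2.2 _ hφ.toLp_mem_H10 M hM
    have ip := integrable_mul_of_ae_bound hp.2.1 (Lp.aestronglyMeasurable _) hM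
    have iq := integrable_mul_of_ae_bound hq.2.1 (Lp.aestronglyMeasurable _) hM
    have zero : ∀ V : L2 Ω, (∀ᵐ x ∂volume.restrict Ω, x ∈ O → V x = 0) →
        ⟪V, (hφ.memLp.toLp : L2 Ω)⟫ = 0 := by
      intro V hV
      rw [L2.inner_def, ← integral_zero (E n) ℝ]
      refine integral_congr_ae ?_
      filter_upwards [hV, hφ.memLp.coeFn_toLp] with x x1 x2
      rw [x2]
      by_cases hx : x ∈ O
      · rw [x1 hx, inner_zero_left]
      · rw [hφO.eq_zero hx, inner_zero_right]
    have hgrad : ⟪q.2 - t • p.2, (hφ.memLp_gradient.toLp : L2Vec Ω)⟫ = 0 := by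
      rw [L2.inner_def, ← integral_zero (E n) ℝ]
      refine integral_congr_ae ?_
      filter_upwards [hg, hφ.memLp_gradient.coeFn_toLp] with x x1 x2
      rw [x2]
      by_cases hx : x ∈ O
      · have := x1 hx
        change (q.2 - t • p.2) x = 0 at this
        rw [this, inner_zero_left]
      · rw [hφO.gradient_eq_zero hx, inner_zero_right]
    rw [inner_sub_left, inner_smul_left, conj_trivial] at hgrad
    rw [zero U hU] at ep
    rw [zero W hW] at eq
    have e : ∫ x in Ω, φ x • (f (q.1 x) - t * f (p.1 x)) =
        (∫ x in Ω, f (q.1 x) * (hφ.memLp.toLp : L2 Ω) x) -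
          t * ∫ x in Ω, f (p.1 x) * (hφ.memLp.toLp : L2 Ω) x := by
      rw [← integral_const_mul, ← integral_sub iq (ip.const_mul t)]
      refine integral_congr_ae ?_
      filter_upwards [hφ.memLp.coeFn_toLp] with x x2
      rw [x2, smul_eq_mul]
      ring
    rw [e]
    linear_combination eq - t * ep - hgrad
  filter_upwards [ae_restrict_of_ae hz, ht] with x x1 x2 hx
  rw [← x2 hx]
  exact sub_eq_zero.1 (x1 hx)

end Locality

/-! ### A control whose effect reaches the annulus. -/

section Observability

variable {n : ℕ} {r R : ℝ} {f : ℝ → ℝ}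

lemma ae_mem_ball_or_mem_annulus (hr : r ≠ 0) :
    ∀ᵐ x ∂volume.restrict (B n R), x ∈ B n r ∨ x ∈ B n R \ Metric.closedBall 0 r := by
  have hs : ∀ᵐ x : E n, x ∉ Metric.sphere (0 : E n) r :=
    measure_eq_zero_iff_ae_notMem.1 (Measure.addHaar_sphere_of_ne_zero volume 0 hr)
  filter_upwards [ae_restrict_of_ae hs, ae_restrict_mem measurableSet_ball] with x x1 x2
  by_cases hx : x ∈ Metric.closedBall (0 : E n) r
  · left
    exact lt_of_le_of_ne hx x1
  · exact Or.inr ⟨x2, hx⟩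

/-- A nonzero constant control is observed outside of the control domain. -/
lemma exists_ne_zero_outside (hn : 1 ≤ n) (hr : 0 < r) (hrR : r < R)
    (hm : StrictMono f) (h0 : f 0 = 0) {U : L2 (B n R)}
    (hU : ∀ᵐ x ∂volume.restrict (B n R), U x = (B n r).indicator (fun _ => f 1) x)
    {p : L2 (B n R) × L2Vec (B n R)} (hp : SatisfiesWeakEquation f U p) :
    ¬ ∀ᵐ x ∂volume.restrict (B n R), x ∈ B n R \ Metric.closedBall 0 r → p.1 x = 0 := by
  intro hz
  have hfin : IsFiniteMeasure (volume.restrict (B n R)) :=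
    isFiniteMeasure_restrict.2 measure_ball_lt_top.ne
  have hO : IsOpen (B n R \ Metric.closedBall 0 r) :=
    Metric.isOpen_ball.sdiff Metric.isClosed_closedBall
  have hg := ae_gradient_eq_zero_of_ae_eq_zero hO sdiff_subset hp.1 hz
  -- The cutoff is `1` on the closed ball of radius `r`, so its gradient lives on the annulus, where
  -- the gradient of `y` is assumed to vanish.
  let η : ContDiffBump (0 : E n) := ⟨r, (r + R) / 2, hr, by linarith⟩
  have hη : IsTestFunction (B n R) η := by
    refine ⟨η.contDiff, η.hasCompactSupport, ?_⟩
    rw [η.tsupport_eq]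
    exact Metric.closedBall_subset_ball (by change (r + R) / 2 < R; linarith)
  have hη1 : ∀ x ∈ B n r, η =ᶠ[𝓝 x] fun _ => 1 := fun x hx => by
    filter_upwards [Metric.isOpen_ball.mem_nhds hx] with y hy
    exact η.one_of_mem_closedBall (Metric.ball_subset_closedBall hy)
  set T := truncation 1 with hT
  -- The desired test function `T (y - 1)` has boundary value `T (-1)`. Subtracting this constant
  -- puts it in H¹₀, and adding `T (-1) η` restores it on the control ball.
  let S : ℝ → ℝ := fun s => T (s - 1) - T (-1)
  have hSd : ∀ s, deriv S s = deriv T (s - 1) := fun s => by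
    change deriv (fun s => T (s - 1) - T (-1)) s = _
    rw [deriv_sub_const, deriv_comp_sub_const]
  have hSc : ContDiff ℝ (⊤ : ℕ∞) S :=
    ((contDiff_truncation 1).comp (contDiff_id.sub contDiff_const)).sub contDiff_const
  obtain ⟨w, hw, w1, w2⟩ := exists_comp_mem_H10 hSc (by simp [S])
    (fun s => by rw [hSd]; exact abs_deriv_truncation_le one_ne_zero _) hp.1
  let e : L2 (B n R) × L2Vec (B n R) := (hη.memLp.toLp, hη.memLp_gradient.toLp)
  set c := T (-1) with hc
  have hq1 : ∀ᵐ x ∂volume.restrict (B n R),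
      (w + c • e).1 x = T (p.1 x - 1) - c + c * η x := by
    filter_upwards [w1, Lp.coeFn_add w.1 (c • e.1), Lp.coeFn_smul c e.1, hη.memLp.coeFn_toLp]
      with x x1 x2 x3 x4
    change (w.1 + c • e.1) x = _
    rw [x2, Pi.add_apply, x3, x1, Pi.smul_apply, x4, smul_eq_mul]
  have hb : ∀ᵐ x ∂volume.restrict (B n R),
      ‖(w + c • e).1 x‖ ≤ 1 * (Real.pi / 2) + |c| + |c| * 1 := by
    filter_upwards [hq1] with x hx
    rw [hx]
    refine (norm_add_le _ _).trans (add_le_add ((norm_sub_le _ _).trans (add_le_add ?_ le_rfl)) ?_)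
    · exact abs_truncation_le one_pos _
    · rw [norm_mul]
      refine mul_le_mul_of_nonneg_left ?_ (abs_nonneg _)
      rw [Real.norm_of_nonneg η.nonneg]
      exact η.le_one
  have heq : ⟪p.2, (w + c • e).2⟫ + ∫ x in B n R, f (p.1 x) * (w + c • e).1 x =
      ⟪U, (w + c • e).1⟫ := hp.2.2 _ ((H10 _).add_mem hw ((H10 _).smul_mem c hη.toLp_mem_H10)) _ hb
  have hge : ⟪p.2, e.2⟫ = 0 := by
    rw [L2.inner_def, ← integral_zero (E n) ℝ]
    refine integral_congr_ae ?_
    filter_upwards [hg, hη.memLp_gradient.coeFn_toLp, ae_mem_ball_or_mem_annulus hr.ne']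
      with x x1 x2 x3
    rw [x2]
    rcases x3 with hx | hx
    · rw [(hη1 x hx).gradient_eq, gradient_fun_const, inner_zero_right]
    · rw [x1 hx, inner_zero_left]
  have i1 := integrable_mul_of_ae_bound hp.2.1 (Lp.aestronglyMeasurable _) hb
  have i2 : Integrable (fun x => U x * (w + c • e).1 x) (volume.restrict (B n R)) :=
    L2.integrable_inner (𝕜 := ℝ) (w + c • e).1 U
  have heq' : ⟪p.2, w.2⟫ + ∫ x in B n R, (f (p.1 x) - U x) * (w + c • e).1 x = 0 := by
    have e1 : ⟪p.2, (w + c • e).2⟫ = ⟪p.2, w.2⟫ := by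
      change ⟪p.2, w.2 + c • e.2⟫ = _
      rw [inner_add_right, inner_smul_right, hge, mul_zero, add_zero]
    have e2 : ⟪U, (w + c • e).1⟫ = ∫ x in B n R, U x * (w + c • e).1 x := by
      rw [real_inner_comm, L2.inner_def]
      rfl
    simp only [sub_mul]
    rw [integral_sub i1 i2, ← e1, ← e2, ← heq]
    ring
  have hin : ∀ᵐ x ∂volume.restrict (B n R), x ∈ B n r →
      (f (p.1 x) - U x) * (w + c • e).1 x = (f (p.1 x) - f 1) * T (p.1 x - 1) := by
    filter_upwards [hq1, hU] with x x1 x2 hx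
    rw [x1, x2, indicator_of_mem hx, (hη1 x hx).self_of_nhds]
    ring
  -- On the control ball `U = f 1`, which makes the product monotone in form; on the annulus `f(y)`
  -- and `U` both vanish.
  have hpos : 0 ≤ᵐ[volume.restrict (B n R)] fun x => (f (p.1 x) - U x) * (w + c • e).1 x := by
    filter_upwards [hin, hU, hz, ae_mem_ball_or_mem_annulus hr.ne'] with x x1 x2 x3 x4
    rcases x4 with hx | hx
    · rw [x1 hx]
      exact mul_truncation_sub_nonneg hm.monotone one_ne_zero _ _
    · have : x ∉ B n r := fun h => hx.2 (Metric.ball_subset_closedBall h)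
      rw [x2, indicator_of_notMem this, x3 hx, h0, sub_zero, zero_mul]
      rfl
  have hw2 : ∀ᵐ x ∂volume.restrict (B n R), w.2 x = deriv T (p.1 x - 1) • p.2 x := by
    filter_upwards [w2] with x hx
    rw [hx, hSd]
  have hnn : 0 ≤ ⟪p.2, w.2⟫ :=
    inner_smul_self_nonneg (fun x => (deriv_truncation_pos one_ne_zero _).le) hw2
  have hI := integral_nonneg_of_ae hpos
  have hgz : ∀ᵐ x ∂volume.restrict (B n R), p.2 x = 0 := by
    have h1 : ⟪p.2, w.2⟫ = 0 := by linarith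
    rw [L2.inner_def, integral_eq_zero_iff_of_nonneg_ae ?_ (L2.integrable_inner _ _)] at h1
    · filter_upwards [h1, hw2] with x x1 x2
      rw [x2, inner_smul_right, real_inner_self_eq_norm_sq] at x1
      have := (mul_eq_zero.1 x1).resolve_left (deriv_truncation_pos one_ne_zero _).ne'
      simpa using this
    · filter_upwards [hw2] with x x2
      rw [x2, inner_smul_right, real_inner_self_eq_norm_sq]
      exact mul_nonneg (deriv_truncation_pos one_ne_zero _).le (sq_nonneg _)
  have hyz : ∀ᵐ x ∂volume.restrict (B n R), x ∈ B n r → p.1 x = 1 := by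
    have h1 : ∫ x in B n R, (f (p.1 x) - U x) * (w + c • e).1 x = 0 := by linarith
    rw [integral_eq_zero_iff_of_nonneg_ae hpos ((i1.sub i2).congr (Eventually.of_forall fun x => by
      simp only [sub_mul, Pi.sub_apply]))] at h1
    filter_upwards [h1, hin] with x x1 x2 hx
    refine eq_of_mul_truncation_sub_eq_zero hm one_ne_zero (a := 1) ?_
    rw [← x2 hx]
    exact x1
  let v : E n := EuclideanSpace.single ⟨0, hn⟩ 1
  have hv : v ≠ 0 := by
    have : ‖v‖ = 1 := by simp [v]
    exact norm_ne_zero_iff.1 (by rw [this]; norm_num)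
  have ha : ContDiff ℝ (⊤ : ℕ∞) (fun x : E n => ⟪v, x⟫) := contDiff_const.inner ℝ contDiff_id
  have hψ := hη.smul_left ha
  -- Now `y` is the indicator of the control ball with zero gradient. On that ball the test function
  -- `⟪v, x⟫ η` has gradient `v`, so the identity reads `|B(0,r)| v = 0`.
  have hwg := hasWeakGradient_of_mem_H10 hp.1 _ hψ
  have e1 : ∫ x in B n R, p.1 x • gradient (fun x => ⟪v, x⟫ * η x) x =
      ∫ x in B n R, (B n r).indicator (fun _ => v) x := by
    refine integral_congr_ae ?_
    filter_upwards [hyz, hz, ae_mem_ball_or_mem_annulus hr.ne'] with x x1 x2 x3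
    rcases x3 with hx | hx
    · rw [x1 hx, one_smul, indicator_of_mem hx]
      have : (fun x => ⟪v, x⟫ * η x) =ᶠ[𝓝 x] fun x => ⟪v, x⟫ := by
        filter_upwards [hη1 x hx] with y hy
        rw [hy, mul_one]
      rw [this.gradient_eq, gradient_inner_left]
    · have : x ∉ B n r := fun h => hx.2 (Metric.ball_subset_closedBall h)
      rw [x2 hx, zero_smul, indicator_of_notMem this]
  have e2 : ∫ x in B n R, (⟪v, x⟫ * η x) • p.2 x = 0 := by
    refine integral_eq_zero_of_ae ?_
    filter_upwards [hgz] with x hx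
    rw [hx, smul_zero]
    rfl
  rw [e1, e2, neg_zero, integral_indicator measurableSet_ball,
    Measure.restrict_restrict_of_subset (Metric.ball_subset_ball hrR.le), setIntegral_const,
    smul_eq_zero, or_iff_left hv, measureReal_eq_zero_iff measure_ball_lt_top.ne] at hwg
  exact (Metric.measure_ball_pos volume (0 : E n) hr).ne' hwg

end Observability

/-! ### From homogeneity along one state to linearity of `f`. -/

section Conclusion

variable {n : ℕ} {r R β : ℝ} {f : ℝ → ℝ}

lemma isLinearMap_of_homogeneous_at {s : ℝ} (hf : Continuous f) (hs : s ≠ 0)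
    (h : ∀ t : ℚ, f (t * s) = t * f s) : IsLinearMap ℝ f := by
  have hreal : (fun t : ℝ => f (t * s)) = fun t => t * f s :=
    Rat.denseRange_cast.equalizer (by fun_prop) (by fun_prop) (funext h)
  have hval : ∀ x, f x = x * (f s / s) := fun x => by
    have := congrFun hreal (x / s)
    simp only [div_mul_cancel₀ x hs] at this
    rw [this]
    ring
  exact ⟨fun x y => by rw [hval, hval x, hval y]; ring, fun c x => by
    rw [hval, hval x, smul_eq_mul, smul_eq_mul]; ring⟩

lemma ae_toLp_indicator_eq_zero (u : L2 (B n r)) : ∀ᵐ x ∂volume.restrict (B n R),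
    x ∈ B n R \ Metric.closedBall 0 r →
      ((memLp_indicator_L2 measurableSet_ball u).toLp : L2 (B n R)) x = 0 := by
  filter_upwards [(memLp_indicator_L2 (Ω := B n R) measurableSet_ball u).coeFn_toLp] with x x1 hx
  rw [x1, indicator_of_notMem fun h => hx.2 (Metric.ball_subset_closedBall h)]

lemma isLinearMap_of_forall_convexOn_J (hn : 1 ≤ n) (hr : 0 < r) (hrR : r < R) (hβ : 0 < β)
    (hf : Continuous f) (hm : StrictMono f) (h0 : f 0 = 0)
    (hJ : ∀ z : L2 (B n R \ B n r), ConvexOn ℝ univ (J f R r β z)) : IsLinearMap ℝ f := by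
  have hfin : IsFiniteMeasure (volume.restrict (B n R)) :=
    isFiniteMeasure_restrict.2 measure_ball_lt_top.ne
  have hfin' : IsFiniteMeasure (volume.restrict (B n r)) :=
    isFiniteMeasure_restrict.2 measure_ball_lt_top.ne
  have hex : ∀ u : L2 (B n r), ∃! y : L2 (B n R), IsWeakSolution f (B n R) (B n r) u y :=
    existsUnique_isWeakSolution hn hrR.le (hr.trans hrR).le hf hm h0
  have hO : IsOpen (B n R \ Metric.closedBall 0 r) :=
    Metric.isOpen_ball.sdiff Metric.isClosed_closedBall
  let u : L2 (B n r) := (memLp_const (f 1)).toLp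
  obtain ⟨g, hg⟩ := exists_satisfiesWeakEquation_state hrR.le hex u
  have hne := exists_ne_zero_outside hn hr hrR hm h0 (by
    have hu : ∀ᵐ x ∂volume.restrict (B n r), u x = f 1 := MemLp.coeFn_toLp _
    rw [ae_restrict_iff' measurableSet_ball] at hu
    filter_upwards [(memLp_indicator_L2 (Ω := B n R) measurableSet_ball u).coeFn_toLp,
      ae_restrict_of_ae hu] with x x1 x2
    rw [x1]
    by_cases hx : x ∈ B n r
    · rw [indicator_of_mem hx, indicator_of_mem hx, x2 hx]
    · rw [indicator_of_notMem hx, indicator_of_notMem hx]) hg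
  have hhom : ∀ t : ℝ, ∀ᵐ x ∂volume.restrict (B n R), x ∈ B n R \ Metric.closedBall 0 r →
      f (t * state f R r u x) = t * f (state f R r u x) := by
    intro t
    obtain ⟨k, hk⟩ := exists_satisfiesWeakEquation_state hrR.le hex (t • u)
    refine hg.ae_homogeneous hO sdiff_subset hk (ae_toLp_indicator_eq_zero _)
      (ae_toLp_indicator_eq_zero _) ?_
    have hobs := observation_smul_of_forall_convexOn hrR.le hβ hex h0 hJ t u
    have h1 : ∀ᵐ x ∂volume.restrict (B n R \ B n r),
        state f R r (t • u) x = t * state f R r u x := by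
      filter_upwards [coeFn_restrictL2 (sdiff_subset : B n R \ B n r ⊆ B n R) (state f R r (t • u)),
        coeFn_restrictL2 (sdiff_subset : B n R \ B n r ⊆ B n R) (state f R r u),
        Lp.coeFn_smul t (observation f R r u)] with x x1 x2 x3
      rw [← x1, ← x2]
      change observation f R r (t • u) x = _
      rw [hobs, x3]
      rfl
    rw [ae_restrict_iff' (measurableSet_ball.diff measurableSet_ball)] at h1
    filter_upwards [ae_restrict_of_ae h1] with x x1 hx
    exact x1 ⟨hx.1, fun h => hx.2 (Metric.ball_subset_closedBall h)⟩
  by_contra hlin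
  refine hne ?_
  -- Only countably many `t` can share one null set; rational ones suffice because `f` is
  -- continuous.
  filter_upwards [ae_all_iff.2 fun t : ℚ => hhom t] with x x1 hx
  by_contra hs
  exact hlin (isLinearMap_of_homogeneous_at hf hs fun t => x1 t hx)

end Conclusion

end InternalControl

theorem theorem1p3 (n : ℕ) (hn1 : 1 ≤ n) (hn3 : n ≤ 3) (r R β : ℝ) (hr : 0 < r) (hrR : r < R)
    (hβ : 0 < β) (f : ℝ → ℝ) (hf1 : ContDiff ℝ 1 f) (hf2 : ContDiffOn ℝ 2 f {0}ᶜ)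
    (hfmono : StrictMono f) (hf0 : f 0 = 0) :
    (∀ u : InternalControl.L2 (InternalControl.B n r),
      ∃! y : InternalControl.L2 (InternalControl.B n R),
        InternalControl.IsWeakSolution f (InternalControl.B n R) (InternalControl.B n r) u y) ∧
    (IsLinearMap ℝ f →
      ∀ z : InternalControl.L2 (InternalControl.B n R \ InternalControl.B n r),
        ConvexOn ℝ Set.univ (InternalControl.J f R r β z)) ∧
    (¬ IsLinearMap ℝ f →
      ∃ z : InternalControl.L2 (InternalControl.B n R \ InternalControl.B n r),
        ¬ ConvexOn ℝ Set.univ (InternalControl.J f R r β z)) := by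
  have hex := fun u => InternalControl.existsUnique_isWeakSolution hn1 hrR.le (hr.trans hrR).le
    hf1.continuous hfmono hf0 u
  refine ⟨hex, fun hlin z => InternalControl.convexOn_J_of_isLinearMap hrR.le hβ.le hex hlin z,
    fun hlin => ?_⟩
  by_contra! hJ
  exact hlin (InternalControl.isLinearMap_of_forall_convexOn_J hn1 hr hrR hβ hf1.continuous
    hfmono hf0 hJ)
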